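/- A rooted chord diagram $C$ with $|C|=n$ chords is a perfect matching of $2n$ points $p_1,\dots,p_{2n}$ placed counterclockwise on a circle, $p_1$ being the root; each matched pair is a chord, and chords are ordered counterclockwise by their first endpoints. Two chords $a<b$ intersect when the endpoints of $b$ are separated by those of $a$; in that case the directed intersection graph has an edge $a\to b$. $C$ is connected if $n\ge 1$ and its intersection graph is connected; let $\mathcal{RCCD}$ be the set of rooted connected chord diagrams. A chord is terminal if it has no outgoing edge. The intersection order of the chords of $C$ is defined recursively: list the first chord (in the counterclockwise order); delete it; then list the connected components of what remains one after the other, in increasing order of their counterclockwise-first chords, each component being listed by the same procedure. Label the chords $1,\dots,n$ in this order. Let $t_1<\dots<t_{k+1}$ be the labels of the terminal chords, and put $b(C)=t_1$, $\delta_j=t_{j+1}-t_j$ for $1\le j\le k$. Given elements $f_0,f_1,f_2,\dots$ of a commutative $\mathbb{Q}$-algebra $R$ (for instance a field of characteristic $0$), put $$f_C=f_0^{\,n-k-1}f_{\delta_1}f_{\delta_2}\cdots f_{\delta_k},$$ and for $i\ge 1$ $$\gamma_i(x)=\frac{(-1)^i}{i!}\sum_{\substack{C\in\mathcal{RCCD}\\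 b(C)\ge i}}x^{|C|}f_C\,f_{b(C)-i}\in R[[x]],\qquad F(\rho)=\frac{f_0}{\rho}+f_1+f_2\rho+f_3\rho^2+\cdots .$$ **Theorem.** The series $G(x,L)=1-\sum_{n\ge 1}\gamma_n(x)L^n\in R[[x]][[L]]$ is a formal solution of the Dyson–Schwinger equation $$G(x,L)=1-x\,G(x,\partial_{-\rho})^{-1}\,(e^{-L\rho}-1)F(\rho)\Big|_{\rho=0},$$ where $\partial_{-\rho}=-\frac{d}{d\rho}$. Explicitly: $G(x,D)$ has an inverse $\sum_{k\ge0}h_k(x)D^k$ in $R[[x]][[D]]$; $\Phi=(e^{-L\rho}-1)F(\rho)$ is a power series in $\rho$ with coefficients in $R[[L]]$; the series $\sum_{k\ge 0}h_k(x)\,\partial_{-\rho}^k\Phi$ converges coefficientwise, the coefficient of each monomial $x^nL^m\rho^r$ in its partial sums being eventually constant; and the equation holds when $G(x,\partial_{-\rho})^{-1}\Phi$ denotes its sum. -/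

import Mathlib

open scoped Classical PowerSeries LaurentSeries

noncomputable section

/-- A rooted chord diagram with `n` chords. The `2 n` points of the circle are numbered
`0, …, 2 n - 1` counterclockwise starting from the root; `partner p` is the other endpoint of the
chord through `p`. -/
@[ext]
structure RootedChordDiagram (n : ℕ) where
  partner : Fin (2 * n) → Fin (2 * n)
  partner_partner : ∀ p, partner (partner p) = p
  partner_ne : ∀ p, partner p ≠ p

instance RootedChordDiagram.instFintype (n : ℕ) : Fintype (RootedChordDiagram n) :=
  Fintype.ofInjective RootedChordDiagram.partner fun _ _ h => RootedChordDiagram.ext h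

namespace RootedChordDiagram

variable {n : ℕ} (D : RootedChordDiagram n)

/-- The chords, each one represented by the endpoint that is met first when going
counterclockwise from the root. The order inherited from `Fin (2 * n)` is the counterclockwise
order of the chords. -/
abbrev Chord : Type := {p : Fin (2 * n) // p < D.partner p}

/-- There is a directed edge from `a` to `b` in the directed intersection graph: `a` precedes `b`
in the counterclockwise order and the two chords intersect. -/
def Edge (a b : D.Chord) : Prop :=
  a.1 < b.1 ∧ b.1 < D.partner a.1 ∧ D.partner a.1 < D.partner b.1

/-- The underlying undirected intersection graph. -/
def intersectionGraph : SimpleGraph D.Chord where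
  Adj a b := D.Edge a b ∨ D.Edge b a
  symm := ⟨fun _ _ h => h.symm⟩
  loopless := ⟨fun _ h => h.elim (fun e => lt_irrefl _ e.1) (fun e => lt_irrefl _ e.1)⟩

/-- The diagram is connected (in particular it has at least one chord). -/
def IsConnected : Prop := D.intersectionGraph.Connected

/-- A chord is terminal if it has no outgoing edge. -/
def IsTerminal (a : D.Chord) : Prop := ∀ b, ¬ D.Edge a b

/-- The connected component of `v` in the intersection graph restricted to the set `S` of
chords. -/
def component (S : Finset D.Chord) (v : D.Chord) : Finset D.Chord :=
  S.filter fun w => ∃ (hv : v ∈ (S : Set D.Chord)) (hw : w ∈ (S : Set D.Chord)),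
    (D.intersectionGraph.induce (S : Set D.Chord)).Reachable ⟨v, hv⟩ ⟨w, hw⟩

theorem mem_component_self {S : Finset D.Chord} {v : D.Chord} (hv : v ∈ S) :
    v ∈ D.component S v :=
  Finset.mem_filter.2 ⟨hv, hv, hv, SimpleGraph.Reachable.refl _⟩

theorem component_subset (S : Finset D.Chord) (v : D.Chord) : D.component S v ⊆ S :=
  Finset.filter_subset _ _

/-- The list of the chords in `S` in the intersection order. The connected components of `S` are
listed one after the other, by increasing smallest chord (counterclockwise), and each of them is
listed as its smallest chord followed by the remaining chords of that component, to which
the same procedure is applied. -/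
def orderOn (S : Finset D.Chord) : List D.Chord :=
  if h : S.Nonempty then
    S.min' h :: (orderOn ((D.component S (S.min' h)).erase (S.min' h)) ++
      orderOn (S \ D.component S (S.min' h)))
  else []
termination_by S.card
decreasing_by
  · exact Finset.card_lt_card
      (lt_of_lt_of_le (Finset.erase_ssubset (D.mem_component_self (S.min'_mem h)))
        (D.component_subset S _))
  · exact Finset.card_lt_card
      (Finset.sdiff_ssubset (D.component_subset S _)
        ⟨_, D.mem_component_self (S.min'_mem h)⟩)

/-- All the chords, in the intersection order. -/
def intersectionOrder : List D.Chord := D.orderOn Finset.univ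

/-- The label of a chord in the intersection order; labels are `1, …, n`. -/
def label (c : D.Chord) : ℕ := D.intersectionOrder.idxOf c + 1

/-- The increasing list of the labels of the terminal chords. -/
def terminalLabels : List ℕ :=
  (D.intersectionOrder.filter fun c => decide (D.IsTerminal c)).map D.label

/-- `b D`, the smallest label of a terminal chord (with the value `0` for the diagram without
chords, which is not connected). -/
def b : ℕ := D.terminalLabels.headD 0

/-- The sequence `δ` of the gaps between consecutive terminal labels. -/
def gaps : List ℕ := List.zipWith (fun i j => j - i) D.terminalLabels D.terminalLabels.tail

/-- The monomial `f_D = f_0 ^ (n - k - 1) f_{δ_1} ⋯ f_{δ_k}`, where `δ = (δ_1, …, δ_k)`. -/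
def monomial {R : Type*} [CommRing R] (f : ℕ → R) : R :=
  f 0 ^ (n - D.gaps.length - 1) * (D.gaps.map f).prod

end RootedChordDiagram

namespace DysonSchwinger

variable {R : Type*} [CommRing R] [Algebra ℚ R]

/-- `γ_i(x) = ((-1)^i / i!) ∑_{C, b(C) ≥ i} x^{|C|} f_C f_{b(C) - i}`, the sum being over the
rooted connected chord diagrams. -/
def gamma (f : ℕ → R) (i : ℕ) : R⟦X⟧ :=
  PowerSeries.mk fun n =>
    algebraMap ℚ R ((-1) ^ i / (i.factorial : ℚ)) *
      ∑ C : RootedChordDiagram n,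
        if C.IsConnected ∧ i ≤ C.b then C.monomial f * f (C.b - i) else 0

/-- `G(x, L) = 1 - ∑_{k ≥ 1} γ_k(x) L^k`, a power series in `L` whose coefficients are power series
in `x`. -/
def greenSeries (γ : ℕ → R⟦X⟧) : R⟦X⟧⟦X⟧ :=
  1 - PowerSeries.mk fun k => if 1 ≤ k then γ k else 0

/-- `e^{-Lρ}` as a power series in `ρ` whose coefficients are series in `x` and `L`. -/
def expNegLRho (R : Type*) [CommRing R] [Algebra ℚ R] : R⟦X⟧⟦X⟧⟦X⟧ :=
  PowerSeries.rescale (-(PowerSeries.X : R⟦X⟧⟦X⟧)) (PowerSeries.exp (R⟦X⟧⟦X⟧))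

/-- The Laurent series `F(ρ) = f_0 / ρ + f_1 + f_2 ρ + ⋯`, with its coefficients viewed as constant
series in `x` and `L`. -/
def laurentF (f : ℕ → R) : (R⟦X⟧⟦X⟧)⸨X⸩ :=
  HahnSeries.single (-1 : ℤ) 1 *
    HahnSeries.ofPowerSeries ℤ (R⟦X⟧⟦X⟧)
      (PowerSeries.mk fun k => PowerSeries.C (PowerSeries.C (f k)))

/-- The operator `∂_{-ρ} = -d/dρ` on power series in `ρ`. -/
def negDeriv {A : Type*} [CommRing A] (Φ : A⟦X⟧) : A⟦X⟧ := -PowerSeries.derivative A Φ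

/-- `Θ = H(x, ∂_{-ρ}) Φ`, where `H(x, D) = ∑_k h_k(x) D^k` is a series in `D` with coefficients
`h_k(x)`: the partial sums of `∑_k h_k(x) ∂_{-ρ}^k Φ` converge formally to `Θ`, that is, the
coefficient of each monomial `x^n L^m ρ^r` is eventually constant with the value it has in `Θ`. -/
def IsOperatorValue (H : R⟦X⟧⟦X⟧) (Φ Θ : R⟦X⟧⟦X⟧⟦X⟧) : Prop :=
  ∀ r m n : ℕ, ∀ᶠ N in Filter.atTop,
    PowerSeries.coeff n (PowerSeries.coeff m (PowerSeries.coeff r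
      (∑ k ∈ Finset.range N,
        PowerSeries.C (PowerSeries.C (PowerSeries.coeff k H)) * negDeriv^[k] Φ))) =
    PowerSeries.coeff n (PowerSeries.coeff m (PowerSeries.coeff r Θ))

/-- `G(x, L)` is a formal solution of the Dyson–Schwinger equation
`G(x, L) = 1 - x G(x, ∂_{-ρ})⁻¹ (e^{-Lρ} - 1) F(ρ) |_{ρ = 0}`. Here `H` is `G(x, D)⁻¹`, `Φ` is
`(e^{-Lρ} - 1) F(ρ)`, which has no pole at `ρ = 0`, and `Θ` is `G(x, ∂_{-ρ})⁻¹ Φ`. -/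
def IsSolution (f : ℕ → R) (G : R⟦X⟧⟦X⟧) : Prop :=
  ∃ (H : R⟦X⟧⟦X⟧) (Φ Θ : R⟦X⟧⟦X⟧⟦X⟧),
    G * H = 1 ∧
    HahnSeries.ofPowerSeries ℤ (R⟦X⟧⟦X⟧) Φ =
      HahnSeries.ofPowerSeries ℤ (R⟦X⟧⟦X⟧) (expNegLRho R - 1) * laurentF f ∧
    IsOperatorValue H Φ Θ ∧
    G = 1 - PowerSeries.C (PowerSeries.X : R⟦X⟧) * PowerSeries.constantCoeff Θ

end DysonSchwinger

end

/-! A root-share decomposition turns the sums over diagrams into differential recursions, and these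
identify `G⁻¹` explicitly.

Delete the root chord of a connected diagram `C` with at least two chords. The component `C₂` of the
second point is the share, and the other chords together with the root form a connected diagram
`C₁`. The points of `C₁` other than the root form an interval lying strictly inside `C₂`. Hence `C`
arises in exactly one way by placing `C₁` into one of the `2|C₂| - 1` slots of `C₂`
(`InsertionData.glue_bijective`). The intersection order lists the root, then `C₂`, then the rest of
`C₁`; the root is not terminal, and the other chords keep their status (`IsInsertion.word_eq`). As
the last chord in the order is always terminal, this gives `b(C) = b(C₂) + 1` and `f_C = f_{b(C₁)-1}
f_{C₁} f_{C₂}`.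

Put `E = 2x d/dx` and `A = ∑ f_{b(C)-1} f_C x^{|C|}`. For every `g`, the series `S(g) = ∑ g(b(C))
f_C x^{|C|}` satisfies `S(g) = g(1) x + A (E - 1) S(g(· + 1))` (`connectedSeries_eq`). Let `Γ_i` be
`γ_i` without its factor `(-1)^i/i!`, and let `x B_b` be the part of `∑ f_C x^{|C|}` with `b(C) =
b`. Then `Γ_1 = A` and `Γ_{i+1} = A (E - 1) Γ_i`, while `B_1 = 1` and `B_{b+1} = A (E + 1) B_b`.
With `H = ∑ (-1)^k/k! B_{k+1} L^k` this says `∂_L G = -A (E - 1) G` and `∂_L H = -A (E + 1) H`. The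
undifferentiated terms cancel in the product: `∂_L (GH) = -A E (GH)`. Since `GH = 1` at `L = 0`, it
follows that `GH = 1` (`green_mul_inverse`).

At `ρ = 0` the operator `∂_{-ρ}^k` extracts `(-1)^k k!` times the `k`-th coefficient of `Φ`, which
cancels the factor in `H`. The right side of the equation becomes `1 - ∑_m (-L)^m/m! ∑_{b ≥ m} x B_b
f_{b-m}` over `m ≥ 1`, which is `G` (`greenSeries_eq`). The series converges because `b(C) ≤ |C|`
makes `B_{k+1}` divisible by `x^k`. -/

noncomputable section

/-! ### Words recording which chords are terminal -/

namespace TerminalWord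

/-- The positions of the letter `true`, the first position being `k`. -/
def positions : ℕ → List Bool → List ℕ
  | _, [] => []
  | k, true :: t => k :: positions (k + 1) t
  | k, false :: t => positions (k + 1) t

/-- The position, counted from `1`, of the first letter `true`. -/
def first : List Bool → ℕ
  | [] => 1
  | true :: _ => 1
  | false :: t => first t + 1

variable {R : Type*} [CommRing R] (f : ℕ → R)

/-- The weight of a word of which the last `true` was read `d + 1` letters before. -/
def weightFrom : ℕ → List Bool → R
  | _, [] => 1
  | d, true :: t => f (d + 1) * weightFrom 0 t
  | d, false :: t => f 0 * weightFrom (d + 1) t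

/-- The weight of a word: a factor `f 0` for each `false` and a factor `f δ` for each gap `δ`
between consecutive letters `true`. -/
def weight : List Bool → R
  | [] => 1
  | true :: t => weightFrom f 0 t
  | false :: t => f 0 * weight t

/-- A final `true` resets the distance counter, so the second factor does not depend on `w` or `d`.
-/
theorem weightFrom_append {w : List Bool} (h : true ∈ w.getLast?) (t : List Bool) (d : ℕ) :
    weightFrom f d (w ++ t) = weightFrom f d w * weightFrom f 0 t := by
  induction w generalizing d with
  | nil => simp at h
  | cons x w ih =>
    rcases w with _ | ⟨y, w⟩
    · obtain rfl : x = true := by simpa using h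
      simp [weightFrom]
    · have h' : true ∈ (y :: w).getLast? := by simpa using h
      cases x
      · simp only [List.cons_append, weightFrom] at ih ⊢
        rw [ih h', mul_assoc]
      · simp only [List.cons_append, weightFrom] at ih ⊢
        rw [ih h', mul_assoc]

theorem weight_append {w : List Bool} (h : true ∈ w.getLast?) (t : List Bool) :
    weight f (w ++ t) = weight f w * weightFrom f 0 t := by
  induction w with
  | nil => simp at h
  | cons x w ih =>
    rcases w with _ | ⟨y, w⟩
    · obtain rfl : x = true := by simpa using h
      simp [weight, weightFrom]
    · have h' : true ∈ (y :: w).getLast? := by simpa using h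
      cases x
      · simp only [List.cons_append, weight] at ih ⊢
        rw [ih h', mul_assoc]
      · simp only [List.cons_append, weight]
        rw [← List.cons_append, weightFrom_append f h']

/-- The distance `d` already covered affects only the gap that ends at the first `true`. -/
theorem weightFrom_eq {w : List Bool} (h : true ∈ w) (d : ℕ) :
    weightFrom f d w = f (d + first w) * weight f w := by
  induction w generalizing d with
  | nil => simp at h
  | cons x w ih =>
    cases x
    · simp only [weightFrom, weight, first]
      rw [ih (by simpa using h), show d + 1 + first w = d + (first w + 1) by omega]
      ring
    · simp [weightFrom, weight, first]

theorem first_append {w : List Bool} (h : true ∈ w) (t : List Bool) :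
    first (w ++ t) = first w := by
  induction w with
  | nil => simp at h
  | cons x w ih =>
    cases x
    · simp only [List.cons_append, first]
      rw [ih (by simpa using h)]
    · simp [first]

theorem one_le_first (w : List Bool) : 1 ≤ first w := by
  rcases w with _ | ⟨x, w⟩
  · simp [first]
  · cases x <;> simp [first]

theorem first_le_length {w : List Bool} (h : true ∈ w) : first w ≤ w.length := by
  induction w with
  | nil => simp at h
  | cons x w ih =>
    cases x
    · have := ih (by simpa using h)
      simpa [first] using this
    · simp [first]

/-- In an insertion, the left side is the contribution of the new root letter `false` and of `C₁`
without its root letter, read just after the final `true` of `C₂`. The gap across the junction is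
one less than the first terminal position of `C₁`; if `C₁` starts with `true`, the factor `f 0` is
itself `f (first - 1)`. -/
theorem mul_weightFrom_tail {x : Bool} {t : List Bool} (h : true ∈ (x :: t).getLast?) :
    f 0 * weightFrom f 0 t = f (first (x :: t) - 1) * weight f (x :: t) := by
  cases x
  · have ht : true ∈ t := by
      have := List.mem_of_mem_getLast? h
      simpa using this
    simp [first, weight, weightFrom_eq f ht]
    ring
  · simp [first, weight]

theorem headD_positions {w : List Bool} (h : true ∈ w) (k : ℕ) :
    (positions (k + 1) w).headD 0 = k + first w := by
  induction w generalizing k with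
  | nil => simp at h
  | cons x w ih =>
    cases x
    · simp only [positions, first]
      rw [ih (by simpa using h)]
      omega
    · simp [positions, first]

theorem length_positions (k : ℕ) (w : List Bool) : (positions k w).length = w.count true := by
  induction w generalizing k with
  | nil => simp [positions]
  | cons x w ih => cases x <;> simp [positions, ih]

/-- Here `p` is the position of the last `true` read, and `d` letters `false` have followed it. -/
theorem weightFrom_eq_gaps (p d : ℕ) (w : List Bool) :
    f 0 ^ w.count false * ((List.zipWith (fun i j => j - i) (p :: positions (p + d + 1) w)
      (positions (p + d + 1) w)).map f).prod = weightFrom f d w := by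
  induction w generalizing p d with
  | nil => simp [positions, weightFrom]
  | cons x w ih =>
    cases x
    · simp only [positions, weightFrom, List.count_cons_self, pow_succ]
      rw [← ih p (d + 1), show p + (d + 1) + 1 = p + d + 1 + 1 by omega]
      ring
    · have h := ih (p + d + 1) 0
      simp only [positions, weightFrom, List.zipWith_cons_cons, List.map_cons, List.prod_cons]
      rw [← h, show p + d + 1 - p = d + 1 by omega, add_zero]
      simp
      ring

theorem weight_eq_gaps (k : ℕ) (w : List Bool) :
    f 0 ^ w.count false * ((List.zipWith (fun i j => j - i) (positions k w)
      (positions k w).tail).map f).prod = weight f w := by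
  induction w generalizing k with
  | nil => simp [positions, weight]
  | cons x w ih =>
    cases x
    · simp only [positions, weight, List.count_cons_self, pow_succ]
      rw [← ih (k + 1)]
      ring
    · simp only [positions, weight, List.tail_cons]
      rw [← weightFrom_eq_gaps f k 0 w]
      simp

theorem map_idxOf_filter {α : Type*} [BEq α] [LawfulBEq α] (p : α → Bool) {l : List α}
    (hl : l.Nodup) (k : ℕ) : (l.filter p).map (fun c => l.idxOf c + k) = positions k (l.map p) := by
  induction l generalizing k with
  | nil => simp [positions]
  | cons x l ih =>
    have hx : x ∉ l := (List.nodup_cons.1 hl).1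
    have key : (l.filter p).map (fun c => (x :: l).idxOf c + k) =
        positions (k + 1) (l.map p) := by
      rw [← ih (List.nodup_cons.1 hl).2]
      refine List.map_congr_left fun c hc => ?_
      have hne : x ≠ c := fun e => hx (e ▸ (List.mem_filter.1 hc).1)
      rw [List.idxOf_cons, beq_false_of_ne hne, cond_false]
      omega
    cases hp : p x
    · rw [List.filter_cons_of_neg (by simp [hp]), key]
      simp [hp, positions]
    · rw [List.filter_cons_of_pos hp]
      simp only [List.map_cons, hp, positions, key, List.idxOf_cons_self, zero_add]

end TerminalWord

namespace RootedChordDiagram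

open Relation

/-! ### Components and the intersection order -/

section Order

variable {n : ℕ} (C : RootedChordDiagram n)

theorem mem_component_iff {S : Finset C.Chord} {v w : C.Chord} (hv : v ∈ S) :
    w ∈ C.component S v ↔
      ReflTransGen (fun a b => C.intersectionGraph.Adj a b ∧ b ∈ S) v w := by
  simp only [component, Finset.mem_filter]
  constructor
  · rintro ⟨-, hv', hw', h⟩
    rw [SimpleGraph.reachable_iff_reflTransGen] at h
    exact ReflTransGen.lift (p := fun a b => C.intersectionGraph.Adj a b ∧ b ∈ S)
      (Subtype.val) (fun a b hab => ⟨hab, b.2⟩) _ _ h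
  · intro h
    induction h with
    | refl => exact ⟨hv, hv, hv, SimpleGraph.Reachable.refl _⟩
    | tail _ hbc ih =>
      obtain ⟨_, _, _, hr⟩ := ih
      refine ⟨hbc.2, hv, hbc.2, hr.trans ?_⟩
      refine SimpleGraph.Adj.reachable ?_
      exact hbc.1

theorem isConnected_iff : C.IsConnected ↔
    Nonempty C.Chord ∧ ∀ v w, ReflTransGen C.intersectionGraph.Adj v w := by
  rw [IsConnected, SimpleGraph.connected_iff, and_comm]
  simp only [SimpleGraph.Preconnected, SimpleGraph.reachable_iff_reflTransGen]

theorem IsConnected.component_univ {C : RootedChordDiagram n} (hC : C.IsConnected)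
    (v : C.Chord) : C.component Finset.univ v = Finset.univ := by
  refine Finset.eq_univ_of_forall fun w => ?_
  rw [mem_component_iff _ (Finset.mem_univ _)]
  simpa using (C.isConnected_iff.1 hC).2 v w

theorem component_component {S : Finset C.Chord} {v : C.Chord} (hv : v ∈ S) :
    C.component (C.component S v) v = C.component S v := by
  refine Finset.Subset.antisymm (C.component_subset _ _) fun w hw => ?_
  rw [mem_component_iff _ (C.mem_component_self hv)]
  rw [mem_component_iff _ hv] at hw
  induction hw with
  | refl => exact ReflTransGen.refl
  | tail h hbc ih =>
    exact ih.tail ⟨hbc.1, (C.mem_component_iff hv).2 (h.tail hbc)⟩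

theorem orderOn_empty : C.orderOn ∅ = [] := by
  rw [orderOn]
  simp

theorem orderOn_of_nonempty {S : Finset C.Chord} (h : S.Nonempty) :
    C.orderOn S = S.min' h :: (C.orderOn ((C.component S (S.min' h)).erase (S.min' h)) ++
      C.orderOn (S \ C.component S (S.min' h))) := by
  rw [orderOn, dif_pos h]

theorem orderOn_eq_append {S : Finset C.Chord} (h : S.Nonempty) :
    C.orderOn S = C.orderOn (C.component S (S.min' h)) ++
      C.orderOn (S \ C.component S (S.min' h)) := by
  have hm := C.mem_component_self (S.min'_mem h)
  have hne : (C.component S (S.min' h)).Nonempty := ⟨_, hm⟩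
  have hmin : (C.component S (S.min' h)).min' hne = S.min' h :=
    le_antisymm (Finset.min'_le _ _ hm)
      (Finset.min'_le _ _ (C.component_subset _ _ (Finset.min'_mem _ _)))
  rw [C.orderOn_of_nonempty h, C.orderOn_of_nonempty hne, hmin,
    C.component_component (S.min'_mem h), Finset.sdiff_self, orderOn_empty]
  simp

theorem IsConnected.intersectionOrder_eq {C : RootedChordDiagram n} (hC : C.IsConnected)
    {v : C.Chord} (hv : ∀ w, v ≤ w) :
    C.intersectionOrder = v :: C.orderOn (Finset.univ.erase v) := by
  have hne : (Finset.univ : Finset C.Chord).Nonempty := ⟨v, Finset.mem_univ _⟩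
  have hmin : Finset.univ.min' hne = v :=
    le_antisymm (Finset.min'_le _ _ (Finset.mem_univ _)) (hv _)
  rw [intersectionOrder, C.orderOn_of_nonempty hne, hmin, hC.component_univ, Finset.sdiff_self,
    orderOn_empty, List.append_nil]

theorem orderOn_spec (S : Finset C.Chord) :
    (C.orderOn S).Nodup ∧ ∀ c, c ∈ C.orderOn S ↔ c ∈ S := by
  induction S using Finset.strongInduction with
  | H S ih =>
    rcases S.eq_empty_or_nonempty with rfl | h
    · simp [orderOn_empty]
    · have hm := C.mem_component_self (S.min'_mem h)
      have hsub := C.component_subset S (S.min' h)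
      obtain ⟨n1, m1⟩ := ih ((C.component S (S.min' h)).erase (S.min' h))
        (lt_of_lt_of_le (Finset.erase_ssubset hm) hsub)
      obtain ⟨n2, m2⟩ := ih (S \ C.component S (S.min' h))
        (Finset.sdiff_ssubset hsub ⟨_, hm⟩)
      rw [C.orderOn_of_nonempty h]
      constructor
      · rw [List.nodup_cons, List.nodup_append]
        refine ⟨?_, n1, n2, ?_⟩
        · simp [m1, m2, hm]
        · rintro a ha _ hb rfl
          rw [m1] at ha
          rw [m2] at hb
          exact (Finset.mem_sdiff.1 hb).2 (Finset.mem_of_mem_erase ha)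
      · intro c
        simp only [List.mem_cons, List.mem_append, m1, m2, Finset.mem_erase, Finset.mem_sdiff]
        constructor
        · rintro (rfl | ⟨-, hc⟩ | ⟨hc, -⟩)
          · exact S.min'_mem h
          · exact hsub hc
          · exact hc
        · intro hc
          by_cases h1 : c = S.min' h
          · exact Or.inl h1
          · by_cases h2 : c ∈ C.component S (S.min' h)
            · exact Or.inr (Or.inl ⟨h1, h2⟩)
            · exact Or.inr (Or.inr ⟨hc, h2⟩)

theorem nodup_intersectionOrder : C.intersectionOrder.Nodup := (C.orderOn_spec _).1

/-- The word which records, along the intersection order, whether each chord is terminal. -/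
def word : List Bool := C.intersectionOrder.map fun c => decide (C.IsTerminal c)

theorem terminalLabels_eq : C.terminalLabels = TerminalWord.positions 1 C.word :=
  TerminalWord.map_idxOf_filter (fun c => decide (C.IsTerminal c)) C.nodup_intersectionOrder 1

theorem b_eq_first (h : true ∈ C.word) : C.b = TerminalWord.first C.word := by
  rw [b, terminalLabels_eq, TerminalWord.headD_positions h 0, zero_add]

theorem length_word : C.word.length = Fintype.card C.Chord := by
  rw [word, List.length_map, ← List.toFinset_card_of_nodup C.nodup_intersectionOrder]
  congr 1
  ext c
  simp [intersectionOrder, (C.orderOn_spec _).2]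

end Order

/-! ### Endpoints of chords -/

section Endpoints

variable {n : ℕ} {C : RootedChordDiagram n}

/-- The first endpoint of a chord. -/
def Chord.lo (c : C.Chord) : ℕ := c.1

/-- The second endpoint of a chord. -/
def Chord.hi (c : C.Chord) : ℕ := C.partner c.1

theorem lo_lt_hi (c : C.Chord) : Chord.lo c < Chord.hi c := c.2

theorem Chord.ext_lo {c d : C.Chord} (h : Chord.lo c = Chord.lo d) : c = d :=
  Subtype.ext (Fin.ext h)

theorem edge_iff {a b : C.Chord} : C.Edge a b ↔
    Chord.lo a < Chord.lo b ∧ Chord.lo b < Chord.hi a ∧ Chord.hi a < Chord.hi b := Iff.rfl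

theorem adj_iff {a b : C.Chord} : C.intersectionGraph.Adj a b ↔
    (Chord.lo a < Chord.lo b ∧ Chord.lo b < Chord.hi a ∧ Chord.hi a < Chord.hi b) ∨
    (Chord.lo b < Chord.lo a ∧ Chord.lo a < Chord.hi b ∧ Chord.hi b < Chord.hi a) := Iff.rfl

theorem partner_injective : Function.Injective C.partner :=
  Function.Involutive.injective C.partner_partner

theorem lo_ne_hi (c d : C.Chord) : Chord.lo c ≠ Chord.hi d := by
  intro h
  have h1 : c.1 = C.partner d.1 := Fin.ext h
  have h2 := c.2
  have h3 := d.2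
  rw [h1, C.partner_partner] at h2
  exact lt_asymm h2 h3

theorem Chord.ext_hi {c d : C.Chord} (h : Chord.hi c = Chord.hi d) : c = d :=
  Subtype.ext (partner_injective (Fin.ext h))

/-- The points that are endpoints of the chords in `S`. -/
def points (S : Finset C.Chord) : Finset (Fin (2 * n)) :=
  S.image (fun c => c.1) ∪ S.image (fun c => C.partner c.1)

theorem mem_points {S : Finset C.Chord} {p : Fin (2 * n)} :
    p ∈ points S ↔ ∃ c ∈ S, p = c.1 ∨ p = C.partner c.1 := by
  simp only [points, Finset.mem_union, Finset.mem_image]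
  constructor
  · rintro (⟨c, hc, rfl⟩ | ⟨c, hc, rfl⟩)
    · exact ⟨c, hc, Or.inl rfl⟩
    · exact ⟨c, hc, Or.inr rfl⟩
  · rintro ⟨c, hc, rfl | rfl⟩
    · exact Or.inl ⟨c, hc, rfl⟩
    · exact Or.inr ⟨c, hc, rfl⟩

theorem partner_mem_points {S : Finset C.Chord} {p : Fin (2 * n)} :
    C.partner p ∈ points S ↔ p ∈ points S := by
  have key : ∀ q : Fin (2 * n), q ∈ points S → C.partner q ∈ points S := by
    intro q hq
    obtain ⟨c, hc, rfl | rfl⟩ := mem_points.1 hq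
    · exact mem_points.2 ⟨c, hc, Or.inr rfl⟩
    · exact mem_points.2 ⟨c, hc, Or.inl (C.partner_partner _)⟩
  exact ⟨fun h => by simpa [C.partner_partner] using key _ h, key p⟩

theorem card_points (S : Finset C.Chord) : (points S).card = 2 * S.card := by
  rw [points, Finset.card_union_of_disjoint, Finset.card_image_of_injective,
    Finset.card_image_of_injective, two_mul]
  · exact partner_injective.comp Subtype.val_injective
  · exact Subtype.val_injective
  · rw [Finset.disjoint_left]
    intro p hp hp'
    obtain ⟨c, -, rfl⟩ := Finset.mem_image.1 hp
    obtain ⟨d, -, h⟩ := Finset.mem_image.1 hp'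
    exact lo_ne_hi c d (congrArg Fin.val h.symm)

variable (C) in
theorem exists_chord (p : Fin (2 * n)) : ∃ c : C.Chord, p = c.1 ∨ p = C.partner c.1 := by
  rcases lt_or_gt_of_ne (C.partner_ne p) with h | h
  · exact ⟨⟨C.partner p, by rwa [C.partner_partner]⟩, Or.inr (C.partner_partner p).symm⟩
  · exact ⟨⟨p, h⟩, Or.inl rfl⟩

theorem points_univ : points (Finset.univ : Finset C.Chord) = Finset.univ :=
  Finset.eq_univ_of_forall fun p => by
    obtain ⟨c, hc⟩ := C.exists_chord p
    exact mem_points.2 ⟨c, Finset.mem_univ _, hc⟩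

variable (C) in
theorem card_chord : Fintype.card C.Chord = n := by
  have h := card_points (Finset.univ : Finset C.Chord)
  rw [points_univ, Finset.card_univ, Finset.card_univ, Fintype.card_fin] at h
  omega

theorem mem_points_lo {S : Finset C.Chord} {c : C.Chord} : c.1 ∈ points S ↔ c ∈ S := by
  rw [mem_points]
  constructor
  · rintro ⟨d, hd, h | h⟩
    · exact Subtype.ext h ▸ hd
    · exact absurd (congrArg Fin.val h) (lo_ne_hi c d)
  · exact fun h => ⟨c, h, Or.inl rfl⟩

end Endpoints

theorem monomial_eq_weight {n : ℕ} (C : RootedChordDiagram n) {R : Type*} [CommRing R]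
    (f : ℕ → R) (h : true ∈ C.word) : C.monomial f = TerminalWord.weight f C.word := by
  rw [← TerminalWord.weight_eq_gaps f 1, monomial, gaps, terminalLabels_eq]
  congr 2
  -- The exponent `n - k - 1` is the number of nonterminal chords. A word containing `true` is
  -- needed for the truncated subtractions to be exact.
  rw [List.length_zipWith, List.length_tail, TerminalWord.length_positions]
  have h1 : 0 < C.word.count true := List.count_pos_iff.2 h
  have h2 := C.word.count_true_add_count_false
  rw [C.length_word, C.card_chord] at h2
  omega

/-! ### Embeddings of chord diagrams -/

section Embedding

variable {m n : ℕ} {D : RootedChordDiagram m} {C : RootedChordDiagram n}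

/-- An order-preserving map of points that sends chords to chords. -/
structure IsEmbedding (D : RootedChordDiagram m) (C : RootedChordDiagram n)
    (φ : Fin (2 * m) → Fin (2 * n)) : Prop where
  strictMono : StrictMono φ
  partner : ∀ p, C.partner (φ p) = φ (D.partner p)

variable {φ : Fin (2 * m) → Fin (2 * n)} (hφ : IsEmbedding D C φ)

namespace IsEmbedding

/-- The map induced on chords by an embedding of diagrams. -/
def chordMap : D.Chord ↪o C.Chord :=
  OrderEmbedding.ofStrictMono
    (fun c => ⟨φ c.1, by rw [hφ.partner]; exact hφ.strictMono c.2⟩)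
    (fun _ _ h => hφ.strictMono h)

theorem lo_chordMap (c : D.Chord) : Chord.lo (hφ.chordMap c) = φ c.1 := rfl

theorem hi_chordMap (c : D.Chord) : Chord.hi (hφ.chordMap c) = φ (D.partner c.1) :=
  congrArg Fin.val (hφ.partner c.1)

theorem edge_chordMap {a b : D.Chord} :
    C.Edge (hφ.chordMap a) (hφ.chordMap b) ↔ D.Edge a b := by
  rw [edge_iff]
  simp only [lo_chordMap, hi_chordMap, Fin.val_fin_lt, hφ.strictMono.lt_iff_lt]
  rfl

theorem adj_chordMap {a b : D.Chord} :
    C.intersectionGraph.Adj (hφ.chordMap a) (hφ.chordMap b) ↔ D.intersectionGraph.Adj a b :=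
  or_congr hφ.edge_chordMap hφ.edge_chordMap

theorem component_map {S : Finset D.Chord} {v : D.Chord} (hv : v ∈ S) :
    C.component (S.map hφ.chordMap.toEmbedding) (hφ.chordMap v) =
      (D.component S v).map hφ.chordMap.toEmbedding := by
  have hv' : hφ.chordMap v ∈ S.map hφ.chordMap.toEmbedding := by simpa using hv
  ext w
  rw [mem_component_iff _ hv', Finset.mem_map]
  simp only [mem_component_iff _ hv, RelEmbedding.coe_toEmbedding]
  constructor
  · intro h
    induction h with
    | refl => exact ⟨v, ReflTransGen.refl, rfl⟩
    | tail _ hbc ih =>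
      obtain ⟨x, hx, rfl⟩ := ih
      obtain ⟨y, hy, rfl⟩ := Finset.mem_map.1 hbc.2
      exact ⟨y, hx.tail ⟨hφ.adj_chordMap.1 hbc.1, hy⟩, rfl⟩
  · rintro ⟨x, hx, rfl⟩
    exact ReflTransGen.lift (p := fun a b => C.intersectionGraph.Adj a b ∧
      b ∈ S.map hφ.chordMap.toEmbedding) hφ.chordMap
      (fun a b hab => ⟨hφ.adj_chordMap.2 hab.1, by simpa using hab.2⟩) _ _ hx

/-- The recursion uses only minima and components, both preserved by an embedding. -/
theorem orderOn_map (S : Finset D.Chord) :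
    C.orderOn (S.map hφ.chordMap.toEmbedding) = (D.orderOn S).map hφ.chordMap := by
  induction S using Finset.strongInduction with
  | H S ih =>
    rcases S.eq_empty_or_nonempty with rfl | h
    · simp [orderOn_empty]
    · have hm := D.mem_component_self (S.min'_mem h)
      have hsub := D.component_subset S (S.min' h)
      have h' : (S.map hφ.chordMap.toEmbedding).Nonempty := by simpa using h
      have hmin : (S.map hφ.chordMap.toEmbedding).min' h' = hφ.chordMap (S.min' h) := by
        refine le_antisymm (Finset.min'_le _ _ (by simpa using S.min'_mem h)) ?_
        refine Finset.le_min' _ _ _ fun y hy => ?_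
        obtain ⟨x, hx, rfl⟩ := Finset.mem_map.1 hy
        exact hφ.chordMap.monotone (Finset.min'_le _ _ hx)
      rw [D.orderOn_of_nonempty h, C.orderOn_of_nonempty h', hmin,
        hφ.component_map (S.min'_mem h), ← Finset.map_sdiff]
      have e : ((D.component S (S.min' h)).map hφ.chordMap.toEmbedding).erase
          (hφ.chordMap (S.min' h)) =
          ((D.component S (S.min' h)).erase (S.min' h)).map hφ.chordMap.toEmbedding :=
        (Finset.map_erase _ _ _).symm
      rw [e, ih _ (lt_of_lt_of_le (Finset.erase_ssubset hm) hsub),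
        ih _ (Finset.sdiff_ssubset hsub ⟨_, hm⟩)]
      simp

end IsEmbedding

end Embedding

end RootedChordDiagram

namespace RootedChordDiagram

open Relation

/-! ### The root chord -/

section Root

variable {n : ℕ} (C : RootedChordDiagram n)

/-- The chord through the root. -/
def root (hn : 0 < n) : C.Chord :=
  ⟨⟨0, by omega⟩, by
    refine lt_of_le_of_ne (Fin.le_def.2 (Nat.zero_le _)) (C.partner_ne _).symm⟩

theorem lo_root (hn : 0 < n) : Chord.lo (C.root hn) = 0 := rfl

theorem root_le (hn : 0 < n) (c : C.Chord) : C.root hn ≤ c :=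
  Fin.le_def.2 (Nat.zero_le _)

theorem IsConnected.pos {C : RootedChordDiagram n} (hC : C.IsConnected) : 0 < n := by
  obtain ⟨c⟩ := (C.isConnected_iff.1 hC).1
  have := c.1.2
  omega

/-- In a connected diagram every point but the root is separated from the root by a chord. -/
theorem IsConnected.exists_straddle {C : RootedChordDiagram n} (hC : C.IsConnected) {j : ℕ}
    (h0 : 0 < j) (hj : j < 2 * n) : ∃ c : C.Chord, Chord.lo c < j ∧ j ≤ Chord.hi c := by
  by_contra! hcon
  have hn : 0 < n := hC.pos
  -- If no chord straddles `j`, crossings cannot lead from chords ending before `j` to later ones,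
  -- yet the root chord and the chord through the last point are connected.
  have key : ∀ v w, ReflTransGen C.intersectionGraph.Adj v w → Chord.hi v < j →
      Chord.hi w < j := by
    intro v w hvw hv
    induction hvw with
    | refl => exact hv
    | @tail c d _ hcd ih =>
      rw [adj_iff] at hcd
      have h1 := hcon d
      have h2 := lo_lt_hi c
      omega
  obtain ⟨u, hu⟩ := C.exists_chord ⟨2 * n - 1, by omega⟩
  have h1 := key _ u ((C.isConnected_iff.1 hC).2 (C.root hn) u) (hcon _ (by rwa [lo_root]))
  have h2 := lo_lt_hi u
  have h3 : 2 * n - 1 = Chord.lo u ∨ 2 * n - 1 = Chord.hi u :=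
    hu.imp (congrArg Fin.val) (congrArg Fin.val)
  omega

end Root

/-! ### Inserting a diagram into another one -/

/-- The sizes `a`, `b` and the slot `j` for which a diagram with `a` chords can be inserted between
the points `j - 1` and `j` of a diagram with `b` chords to give a diagram with `n` chords. -/
structure IsSlot (n a b j : ℕ) : Prop where
  pos_left : 0 < a
  pos_slot : 0 < j
  slot_lt : j < 2 * b
  add_eq : a + b = n

section Insertion

variable {n a b j : ℕ} (h : IsSlot n a b j)

/-- The position of the points of the inserted diagram: the root stays first, the other ones go
to the slot. -/
def rootEmb (p : Fin (2 * a)) : Fin (2 * n) :=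
  ⟨if p.1 = 0 then 0 else p.1 + j, by
    obtain ⟨h1, h2, h3, h4⟩ := h
    split_ifs <;> omega⟩

/-- The position of the points of the diagram that receives the insertion. -/
def shareEmb (p : Fin (2 * b)) : Fin (2 * n) :=
  ⟨if p.1 < j then p.1 + 1 else p.1 + 2 * a, by
    obtain ⟨h1, h2, h3, h4⟩ := h
    split_ifs <;> omega⟩

theorem val_rootEmb (p : Fin (2 * a)) :
    (rootEmb h p : ℕ) = if p.1 = 0 then 0 else p.1 + j := rfl

theorem val_shareEmb (p : Fin (2 * b)) :
    (shareEmb h p : ℕ) = if p.1 < j then p.1 + 1 else p.1 + 2 * a := rfl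

theorem strictMono_rootEmb : StrictMono (rootEmb h) := by
  intro p q hpq
  rw [Fin.lt_def] at hpq ⊢
  rw [val_rootEmb, val_rootEmb]
  split_ifs <;> omega

theorem strictMono_shareEmb : StrictMono (shareEmb h) := by
  intro p q hpq
  have := h.pos_left
  rw [Fin.lt_def] at hpq ⊢
  rw [val_shareEmb, val_shareEmb]
  split_ifs <;> omega

theorem mem_range_rootEmb {p : Fin (2 * n)} :
    p ∈ Set.range (rootEmb h) ↔ p.1 = 0 ∨ j < p.1 ∧ p.1 < j + 2 * a := by
  obtain ⟨h1, h2, h3, h4⟩ := id h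
  constructor
  · rintro ⟨q, rfl⟩
    have := q.2
    rw [val_rootEmb]
    split_ifs <;> omega
  · rintro (hp | hp)
    · exact ⟨⟨0, by omega⟩, Fin.ext (by rw [val_rootEmb]; simp [hp])⟩
    · refine ⟨⟨p.1 - j, by omega⟩, Fin.ext ?_⟩
      rw [val_rootEmb]
      dsimp only
      split_ifs <;> omega

theorem mem_range_shareEmb {p : Fin (2 * n)} :
    p ∈ Set.range (shareEmb h) ↔ 0 < p.1 ∧ p.1 ≤ j ∨ j + 2 * a ≤ p.1 := by
  obtain ⟨h1, h2, h3, h4⟩ := id h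
  constructor
  · rintro ⟨q, rfl⟩
    have := q.2
    rw [val_shareEmb]
    split_ifs <;> omega
  · rintro (hp | hp)
    · refine ⟨⟨p.1 - 1, by omega⟩, Fin.ext ?_⟩
      rw [val_shareEmb]
      dsimp only
      split_ifs <;> omega
    · refine ⟨⟨p.1 - 2 * a, by omega⟩, Fin.ext ?_⟩
      rw [val_shareEmb]
      dsimp only
      split_ifs <;> omega

theorem mem_range_shareEmb_iff_not {p : Fin (2 * n)} :
    p ∈ Set.range (shareEmb h) ↔ p ∉ Set.range (rootEmb h) := by
  have := h.pos_left
  rw [mem_range_shareEmb, mem_range_rootEmb]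
  omega

theorem bijective_sumElim : Function.Bijective (Sum.elim (rootEmb h) (shareEmb h)) := by
  constructor
  · refine (strictMono_rootEmb h).injective.sumElim (strictMono_shareEmb h).injective ?_
    intro p q e
    exact (mem_range_shareEmb_iff_not h).1 ⟨q, rfl⟩ ⟨p, e⟩
  · intro p
    by_cases hp : p ∈ Set.range (rootEmb h)
    · obtain ⟨q, rfl⟩ := hp
      exact ⟨Sum.inl q, rfl⟩
    · obtain ⟨q, rfl⟩ := (mem_range_shareEmb_iff_not h).2 hp
      exact ⟨Sum.inr q, rfl⟩

/-- `C` is obtained by inserting `C₁` into the slot `j` of `C₂`. -/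
structure IsInsertion (h : IsSlot n a b j) (C₁ : RootedChordDiagram a) (C₂ : RootedChordDiagram b)
    (C : RootedChordDiagram n) : Prop where
  left : IsEmbedding C₁ C (rootEmb h)
  right : IsEmbedding C₂ C (shareEmb h)

/-- The insertion of `C₁` into the slot `j` of `C₂`. -/
def insertion (C₁ : RootedChordDiagram a) (C₂ : RootedChordDiagram b) :
    RootedChordDiagram n where
  partner p := Sum.elim (rootEmb h) (shareEmb h) (Sum.map C₁.partner C₂.partner
    ((Equiv.ofBijective _ (bijective_sumElim h)).symm p))
  partner_partner p := by
    obtain ⟨q, rfl⟩ := (Equiv.ofBijective _ (bijective_sumElim h)).surjective p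
    have key : ∀ s, (Equiv.ofBijective _ (bijective_sumElim h)).symm
        (Sum.elim (rootEmb h) (shareEmb h) s) = s :=
      (Equiv.ofBijective _ (bijective_sumElim h)).symm_apply_apply
    simp only [Equiv.ofBijective_apply, key]
    rcases q with q | q <;> simp [partner_partner]
  partner_ne p := by
    obtain ⟨q, rfl⟩ := (Equiv.ofBijective _ (bijective_sumElim h)).surjective p
    have key : ∀ s, (Equiv.ofBijective _ (bijective_sumElim h)).symm
        (Sum.elim (rootEmb h) (shareEmb h) s) = s :=
      (Equiv.ofBijective _ (bijective_sumElim h)).symm_apply_apply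
    simp only [Equiv.ofBijective_apply, key]
    intro e
    have e' := (bijective_sumElim h).1 e
    rcases q with q | q
    · exact C₁.partner_ne q (Sum.inl.inj e')
    · exact C₂.partner_ne q (Sum.inr.inj e')

theorem isInsertion_insertion (C₁ : RootedChordDiagram a) (C₂ : RootedChordDiagram b) :
    IsInsertion h C₁ C₂ (insertion h C₁ C₂) := by
  have key : ∀ s, (Equiv.ofBijective _ (bijective_sumElim h)).symm
      (Sum.elim (rootEmb h) (shareEmb h) s) = s :=
    (Equiv.ofBijective _ (bijective_sumElim h)).symm_apply_apply
  refine ⟨⟨strictMono_rootEmb h, fun p => ?_⟩, ⟨strictMono_shareEmb h, fun p => ?_⟩⟩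
  · have := key (Sum.inl p)
    simp only [Sum.elim_inl] at this
    simp [insertion, this]
  · have := key (Sum.inr p)
    simp only [Sum.elim_inr] at this
    simp [insertion, this]

namespace IsInsertion

variable {h} {C₁ : RootedChordDiagram a} {C₂ : RootedChordDiagram b}
  {C C' : RootedChordDiagram n}

theorem unique (hC : IsInsertion h C₁ C₂ C) (hC' : IsInsertion h C₁ C₂ C') : C = C' := by
  ext1
  funext p
  obtain ⟨q | q, rfl⟩ := (bijective_sumElim h).2 p
  · rw [Sum.elim_inl, hC.left.partner, hC'.left.partner]
  · rw [Sum.elim_inr, hC.right.partner, hC'.right.partner]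

theorem exists_chordMap (hC : IsInsertion h C₁ C₂ C) (c : C.Chord) :
    (∃ d, c = hC.left.chordMap d) ∨ ∃ d, c = hC.right.chordMap d := by
  obtain ⟨q | q, hq⟩ := (bijective_sumElim h).2 c.1
  · refine Or.inl ⟨⟨q, ?_⟩, Subtype.ext hq.symm⟩
    have hc := c.2
    rw [← hq, Sum.elim_inl, hC.left.partner] at hc
    exact hC.left.strictMono.lt_iff_lt.1 hc
  · refine Or.inr ⟨⟨q, ?_⟩, Subtype.ext hq.symm⟩
    have hc := c.2
    rw [← hq, Sum.elim_inr, hC.right.partner] at hc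
    exact hC.right.strictMono.lt_iff_lt.1 hc

theorem chordMap_ne (hC : IsInsertion h C₁ C₂ C) (c : C₁.Chord) (d : C₂.Chord) :
    hC.left.chordMap c ≠ hC.right.chordMap d := fun e =>
  (mem_range_shareEmb_iff_not h).1 ⟨d.1, (congrArg Subtype.val e).symm⟩ ⟨c.1, rfl⟩

/-- A chord of `C₁` other than the root chord lies within the slot and crosses nothing in `C₂`; the
root chord crosses some chords of `C₂` but precedes them all. -/
theorem not_edge_right_left (hC : IsInsertion h C₁ C₂ C) (c : C₁.Chord) (d : C₂.Chord) :
    ¬ C.Edge (hC.right.chordMap d) (hC.left.chordMap c) := by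
  rw [edge_iff]
  simp only [IsEmbedding.lo_chordMap, IsEmbedding.hi_chordMap, val_rootEmb, val_shareEmb]
  have h1 := Fin.lt_def.1 c.2
  have h2 := Fin.lt_def.1 d.2
  have h3 := (C₁.partner c.1).2
  split_ifs <;> omega

theorem lo_eq_zero_of_edge (hC : IsInsertion h C₁ C₂ C) {c : C₁.Chord} {d : C₂.Chord}
    (e : C.Edge (hC.left.chordMap c) (hC.right.chordMap d)) : Chord.lo c = 0 := by
  rw [edge_iff] at e
  simp only [IsEmbedding.lo_chordMap, IsEmbedding.hi_chordMap, val_rootEmb, val_shareEmb] at e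
  have h1 := Fin.lt_def.1 c.2
  have h2 := Fin.lt_def.1 d.2
  have h3 := (C₁.partner c.1).2
  change c.1.1 = 0
  split_ifs at e <;> omega

theorem edge_root (hC : IsInsertion h C₁ C₂ C) {d : C₂.Chord} (h1 : Chord.lo d < j)
    (h2 : j ≤ Chord.hi d) :
    C.Edge (hC.left.chordMap (C₁.root h.pos_left)) (hC.right.chordMap d) := by
  rw [edge_iff]
  simp only [IsEmbedding.lo_chordMap, IsEmbedding.hi_chordMap, val_rootEmb, val_shareEmb]
  have e1 : ((C₁.root h.pos_left).1 : ℕ) = 0 := rfl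
  have e2 := Fin.lt_def.1 (C₁.root h.pos_left).2
  have e3 := (C₁.partner (C₁.root h.pos_left).1).2
  have e4 : (d.1 : ℕ) < j := h1
  have e5 : j ≤ (C₂.partner d.1 : ℕ) := h2
  split_ifs <;> omega

theorem chordMap_root (hC : IsInsertion h C₁ C₂ C) (hn : 0 < n) :
    hC.left.chordMap (C₁.root h.pos_left) = C.root hn := by
  refine Chord.ext_lo ?_
  rw [IsEmbedding.lo_chordMap, val_rootEmb]
  rfl

theorem lo_chordMap_root (hC : IsInsertion h C₁ C₂ C) (hb : 0 < b) :
    Chord.lo (hC.right.chordMap (C₂.root hb)) = 1 := by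
  rw [IsEmbedding.lo_chordMap, val_shareEmb]
  have : ((C₂.root hb).1 : ℕ) = 0 := rfl
  rw [this, if_pos h.pos_slot]

theorem exists_edge_root (hC : IsInsertion h C₁ C₂ C) (h₂ : C₂.IsConnected) :
    ∃ d, C.Edge (hC.left.chordMap (C₁.root h.pos_left)) (hC.right.chordMap d) := by
  obtain ⟨d, hd, hd'⟩ := h₂.exists_straddle h.pos_slot h.slot_lt
  exact ⟨d, hC.edge_root hd hd'⟩

theorem isConnected (hC : IsInsertion h C₁ C₂ C) (h₁ : C₁.IsConnected) (h₂ : C₂.IsConnected) :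
    C.IsConnected := by
  set r := hC.left.chordMap (C₁.root h.pos_left) with hr
  have sym : ∀ x y, ReflTransGen C.intersectionGraph.Adj x y →
      ReflTransGen C.intersectionGraph.Adj y x := by
    intro x y hxy
    rw [← SimpleGraph.reachable_iff_reflTransGen] at hxy ⊢
    exact hxy.symm
  have key : ∀ c, ReflTransGen C.intersectionGraph.Adj r c := by
    intro c
    rcases hC.exists_chordMap c with ⟨d, rfl⟩ | ⟨d, rfl⟩
    · exact ReflTransGen.lift (p := C.intersectionGraph.Adj) hC.left.chordMap
        (fun _ _ e => hC.left.adj_chordMap.2 e) _ _ ((C₁.isConnected_iff.1 h₁).2 _ d)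
    · obtain ⟨u, hu⟩ := hC.exists_edge_root h₂
      refine ReflTransGen.head (Or.inl hu) ?_
      exact ReflTransGen.lift (p := C.intersectionGraph.Adj) hC.right.chordMap
        (fun _ _ e => hC.right.adj_chordMap.2 e) _ _ ((C₂.isConnected_iff.1 h₂).2 _ d)
  exact C.isConnected_iff.2 ⟨⟨r⟩, fun v w => (sym _ _ (key v)).trans (key w)⟩

theorem component_eq (hC : IsInsertion h C₁ C₂ C) (h₂ : C₂.IsConnected) (d : C₂.Chord) :
    C.component (Finset.univ.erase (hC.left.chordMap (C₁.root h.pos_left)))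
      (hC.right.chordMap d) = Finset.univ.map hC.right.chordMap.toEmbedding := by
  have hne : ∀ d, hC.right.chordMap d ∈
      Finset.univ.erase (hC.left.chordMap (C₁.root h.pos_left)) := fun d =>
    Finset.mem_erase.2 ⟨(hC.chordMap_ne _ _).symm, Finset.mem_univ _⟩
  ext w
  rw [mem_component_iff _ (hne d)]
  simp only [Finset.mem_map, Finset.mem_univ, true_and, RelEmbedding.coe_toEmbedding]
  constructor
  · intro hw
    induction hw with
    | refl => exact ⟨d, rfl⟩
    | @tail _ c _ hbc ih =>
      obtain ⟨x, rfl⟩ := ih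
      rcases hC.exists_chordMap c with ⟨y, rfl⟩ | ⟨y, rfl⟩
      · rcases hbc.1 with e | e
        · exact absurd e (hC.not_edge_right_left _ _)
        · have hy := hC.lo_eq_zero_of_edge e
          have : y = C₁.root h.pos_left := Chord.ext_lo hy
          exact absurd (congrArg _ this) (Finset.mem_erase.1 hbc.2).1
      · exact ⟨y, rfl⟩
  · rintro ⟨x, rfl⟩
    exact ReflTransGen.lift (p := fun u v => C.intersectionGraph.Adj u v ∧
      v ∈ Finset.univ.erase (hC.left.chordMap (C₁.root h.pos_left))) hC.right.chordMap
      (fun u v e => ⟨hC.right.adj_chordMap.2 e, hne v⟩) _ _ ((C₂.isConnected_iff.1 h₂).2 d x)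

theorem isTerminal_right (hC : IsInsertion h C₁ C₂ C) (d : C₂.Chord) :
    C.IsTerminal (hC.right.chordMap d) ↔ C₂.IsTerminal d := by
  constructor
  · exact fun ht x hx => ht _ (hC.right.edge_chordMap.2 hx)
  · intro ht x hx
    rcases hC.exists_chordMap x with ⟨y, rfl⟩ | ⟨y, rfl⟩
    · exact hC.not_edge_right_left _ _ hx
    · exact ht y (hC.right.edge_chordMap.1 hx)

theorem isTerminal_left (hC : IsInsertion h C₁ C₂ C) {c : C₁.Chord}
    (hc : c ≠ C₁.root h.pos_left) :
    C.IsTerminal (hC.left.chordMap c) ↔ C₁.IsTerminal c := by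
  constructor
  · exact fun ht x hx => ht _ (hC.left.edge_chordMap.2 hx)
  · intro ht x hx
    rcases hC.exists_chordMap x with ⟨y, rfl⟩ | ⟨y, rfl⟩
    · exact ht y (hC.left.edge_chordMap.1 hx)
    · exact hc (Chord.ext_lo (hC.lo_eq_zero_of_edge hx))

/-- Without the root, the smallest chord is the root of `C₂`, which starts at point `1`, and its
component is `C₂`. What remains is `C₁` without its root, possibly disconnected. -/
theorem intersectionOrder_eq (hC : IsInsertion h C₁ C₂ C) (h₁ : C₁.IsConnected)
    (h₂ : C₂.IsConnected) :
    C.intersectionOrder = hC.left.chordMap (C₁.root h.pos_left) ::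
      (C₂.intersectionOrder.map hC.right.chordMap ++
        (C₁.orderOn (Finset.univ.erase (C₁.root h.pos_left))).map hC.left.chordMap) := by
  have hn : 0 < n := (hC.isConnected h₁ h₂).pos
  have hb : 0 < b := h₂.pos
  rw [(hC.isConnected h₁ h₂).intersectionOrder_eq (C.root_le hn), ← hC.chordMap_root hn]
  congr 1
  have hm : hC.right.chordMap (C₂.root hb) ∈
      Finset.univ.erase (hC.left.chordMap (C₁.root h.pos_left)) :=
    Finset.mem_erase.2 ⟨(hC.chordMap_ne _ _).symm, Finset.mem_univ _⟩
  have hne : (Finset.univ.erase (hC.left.chordMap (C₁.root h.pos_left))).Nonempty := ⟨_, hm⟩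
  have hmin : (Finset.univ.erase (hC.left.chordMap (C₁.root h.pos_left))).min' hne =
      hC.right.chordMap (C₂.root hb) := by
    refine le_antisymm (Finset.min'_le _ _ hm) (Finset.le_min' _ _ _ fun y hy => ?_)
    have hy' := (Finset.mem_erase.1 hy).1
    rw [hC.chordMap_root hn] at hy'
    have h0 : Chord.lo y ≠ 0 := fun e => hy' (Chord.ext_lo e)
    change Chord.lo _ ≤ Chord.lo y
    rw [hC.lo_chordMap_root hb]
    omega
  rw [C.orderOn_eq_append hne, hmin, hC.component_eq h₂, hC.right.orderOn_map,
    ← hC.left.orderOn_map]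
  congr 2
  ext c
  simp only [Finset.mem_sdiff, Finset.mem_erase, Finset.mem_univ, and_true, Finset.mem_map,
    true_and, RelEmbedding.coe_toEmbedding]
  constructor
  · rintro ⟨h3, h4⟩
    rcases hC.exists_chordMap c with ⟨y, rfl⟩ | ⟨y, rfl⟩
    · exact ⟨y, fun e => h3 (by rw [e]), rfl⟩
    · exact absurd ⟨y, rfl⟩ h4
  · rintro ⟨y, hy, rfl⟩
    refine ⟨fun e => hy (hC.left.chordMap.injective e), ?_⟩
    rintro ⟨z, hz⟩
    exact hC.chordMap_ne _ _ hz.symm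

theorem word_eq (hC : IsInsertion h C₁ C₂ C) (h₁ : C₁.IsConnected) (h₂ : C₂.IsConnected) :
    C.word = false :: (C₂.word ++ C₁.word.tail) := by
  have hroot : ¬ C.IsTerminal (hC.left.chordMap (C₁.root h.pos_left)) := by
    obtain ⟨d, hd⟩ := hC.exists_edge_root h₂
    exact fun ht => ht _ hd
  rw [word, hC.intersectionOrder_eq h₁ h₂, word, word,
    h₁.intersectionOrder_eq (C₁.root_le h.pos_left)]
  simp only [List.map_cons, List.map_append, List.map_map, List.tail_cons, hroot, decide_false]
  congr 2
  · refine List.map_congr_left fun d _ => ?_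
    simp only [Function.comp_apply, hC.isTerminal_right]
  · refine List.map_congr_left fun d hd => ?_
    rw [(C₁.orderOn_spec _).2] at hd
    simp only [Function.comp_apply, hC.isTerminal_left (Finset.ne_of_mem_erase hd)]

end IsInsertion

end Insertion

end RootedChordDiagram

namespace RootedChordDiagram

open Relation

/-! ### Decomposing a connected diagram -/

section Decomposition

/-- A set of points stable under taking partners carries a diagram. -/
theorem exists_restriction {m n : ℕ} (C : RootedChordDiagram n) {φ : Fin (2 * m) → Fin (2 * n)}
    (hφ : StrictMono φ) (hr : ∀ p ∈ Set.range φ, C.partner p ∈ Set.range φ) :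
    ∃ D : RootedChordDiagram m, IsEmbedding D C φ := by
  choose g hg using fun p => hr (φ p) ⟨p, rfl⟩
  refine ⟨⟨g, fun p => hφ.injective ?_, fun p e => ?_⟩, ⟨hφ, fun p => (hg p).symm⟩⟩
  · rw [hg, hg, C.partner_partner]
  · have := hg p
    rw [e] at this
    exact C.partner_ne _ this.symm

theorem Chord.disjoint {n : ℕ} {C : RootedChordDiagram n} {c d : C.Chord} (h : c ≠ d) :
    Chord.lo c ≠ Chord.lo d ∧ Chord.lo c ≠ Chord.hi d ∧ Chord.hi c ≠ Chord.lo d ∧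
      Chord.hi c ≠ Chord.hi d :=
  ⟨fun e => h (Chord.ext_lo e), lo_ne_hi c d, (lo_ne_hi d c).symm, fun e => h (Chord.ext_hi e)⟩

variable {n : ℕ} {C : RootedChordDiagram n}

/-- `K` is the connected component of the second chord after the root chord `r` is deleted. -/
structure IsShare (r m : C.Chord) (K : Finset C.Chord) : Prop where
  lo_root : Chord.lo r = 0
  lo_second : Chord.lo m = 1
  second_mem : m ∈ K
  root_notMem : r ∉ K
  mem_of_adj : ∀ c ∈ K, ∀ d, C.intersectionGraph.Adj c d → d ≠ r → d ∈ K
  induction_on : ∀ P : C.Chord → Prop, P m →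
    (∀ c ∈ K, ∀ d ∈ K, C.intersectionGraph.Adj c d → P c → P d) → ∀ c ∈ K, P c
  induction_off : ∀ P : C.Chord → Prop, P r →
    (∀ c, c ∉ K → c ≠ r → ∀ d, d ∉ K → C.intersectionGraph.Adj c d → P d → P c) →
    ∀ c, c ∉ K → P c

theorem IsConnected.exists_isShare (hC : C.IsConnected) (hn : 2 ≤ n) :
    ∃ m, IsShare (C.root (by omega)) m
      (C.component (Finset.univ.erase (C.root (by omega))) m) := by
  have hpos : 0 < n := by omega
  set r := C.root hpos with hr
  have hr0 : Chord.lo r = 0 := rfl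
  obtain ⟨c, hc1, hc2⟩ : ∃ c : C.Chord, Chord.lo c = 1 ∧ c ≠ r := by
    -- If the root chord ended at `1`, no chord could straddle the point `2`.
    have h2 : Chord.hi r ≠ 1 := by
      intro e
      obtain ⟨c, h3, h4⟩ := hC.exists_straddle (j := 2) (by omega) (by omega)
      have h5 : c ≠ r := fun e' => by rw [e'] at h4; omega
      have h6 := Chord.disjoint h5
      omega
    obtain ⟨c, hc⟩ := C.exists_chord ⟨1, by omega⟩
    have hc : 1 = Chord.lo c ∨ 1 = Chord.hi c :=
      hc.imp (congrArg Fin.val) (congrArg Fin.val)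
    have h3 := lo_lt_hi c
    rcases hc with hc | hc
    · exact ⟨c, hc.symm, fun e => by rw [e] at hc; omega⟩
    · have : c = r := Chord.ext_lo (by omega)
      rw [this] at hc
      omega
  have hm : c ∈ Finset.univ.erase r := Finset.mem_erase.2 ⟨hc2, Finset.mem_univ _⟩
  have hadj : ∀ x ∈ C.component (Finset.univ.erase r) c, ∀ y, C.intersectionGraph.Adj x y →
      y ≠ r → y ∈ C.component (Finset.univ.erase r) c := by
    intro x hx y hxy hy
    rw [mem_component_iff _ hm] at hx ⊢
    exact hx.tail ⟨hxy, Finset.mem_erase.2 ⟨hy, Finset.mem_univ _⟩⟩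
  refine ⟨c, rfl, hc1, C.mem_component_self hm, fun h => ?_, hadj, ?_, ?_⟩
  · exact (Finset.mem_erase.1 (C.component_subset _ _ h)).1 rfl
  · intro P hP hstep x hx
    have hx' := (C.mem_component_iff hm).1 hx
    clear hx
    induction hx' with
    | refl => exact hP
    | tail hab hbc ih =>
      exact hstep _ ((C.mem_component_iff hm).2 hab) _ ((C.mem_component_iff hm).2 (hab.tail hbc))
        hbc.1 ih
  · intro P hP hstep x
    induction (C.isConnected_iff.1 hC).2 x r using ReflTransGen.head_induction_on with
    | refl => exact fun _ => hP
    | @head x y hxy _ ih =>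
      intro hx
      by_cases hxr : x = r
      · exact hxr ▸ hP
      · have hy : y ∉ C.component (Finset.univ.erase r) c := fun hy =>
          hx (hadj y hy x hxy.symm hxr)
        exact hstep x hx hxr y hy hxy (ih hy)

namespace IsShare

variable {r m : C.Chord} {K : Finset C.Chord}

theorem not_adj (hK : IsShare r m K) {k c : C.Chord} (hk : k ∈ K) (hc : c ∉ K) (hr : c ≠ r) :
    ¬ C.intersectionGraph.Adj k c := fun e => hc (hK.mem_of_adj k hk c e hr)

theorem lo_pos (hK : IsShare r m K) {c : C.Chord} (hr : c ≠ r) : 0 < Chord.lo c := by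
  rcases Nat.eq_zero_or_pos (Chord.lo c) with h | h
  · exact absurd (Chord.ext_lo (h.trans hK.lo_root.symm)) hr
  · exact h

/-- The chords of the share are not enclosed by the chords outside of it. -/
theorem not_enclosed (hK : IsShare r m K) {c : C.Chord} (hc : c ∉ K) (hr : c ≠ r) :
    ∀ k ∈ K, ¬ (Chord.lo c < Chord.lo k ∧ Chord.lo k < Chord.hi c) := by
  have hpos := hK.lo_pos hr
  -- The chord `m` starts at `1`, too early to be enclosed by `c`. A chord of the share enclosed by
  -- `c` can only meet chords enclosed by `c` or crossing it, and none of the share crosses `c`.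
  refine hK.induction_on _ ?_ ?_
  · have := hK.lo_second
    omega
  · intro k hk k' hk' hadj ih
    have h1 := hK.not_adj hk hc hr
    have h2 := hK.not_adj hk' hc hr
    have h3 := Chord.disjoint (ne_of_mem_of_not_mem hk hc)
    have h4 := Chord.disjoint (ne_of_mem_of_not_mem hk' hc)
    have h5 := lo_lt_hi k
    have h6 := lo_lt_hi k'
    have h7 := lo_lt_hi c
    rw [adj_iff] at h1 h2 hadj
    omega

/-- No chord of the share separates the points outside of it from each other. -/
theorem same_side (hK : IsShare r m K) {k : C.Chord} (hk : k ∈ K) : ∀ c, c ∉ K → (c ≠ r →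
    ((Chord.lo k < Chord.lo c ∧ Chord.lo c < Chord.hi k) ↔
      (Chord.lo k < Chord.hi r ∧ Chord.hi r < Chord.hi k)) ∧
    ((Chord.lo k < Chord.hi c ∧ Chord.hi c < Chord.hi k) ↔
      (Chord.lo k < Chord.hi r ∧ Chord.hi r < Chord.hi k))) := by
  -- Induction along a path to the root outside the share. As `k` neither crosses `c` nor is
  -- enclosed by it, both ends of `c` lie on one side of `k`; the crossing with `d` carries over the
  -- side of `d`.
  refine hK.induction_off _ (fun e => absurd rfl e) ?_
  intro c hc hcr d hd hadj ih _
  have h1 := hK.not_adj hk hc hcr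
  have h2 := hK.not_enclosed hc hcr k hk
  have h3 := Chord.disjoint (ne_of_mem_of_not_mem hk hc)
  have h4 := Chord.disjoint (ne_of_mem_of_not_mem hk hK.root_notMem)
  have h5 := lo_lt_hi k
  have h6 := lo_lt_hi c
  have h7 := lo_lt_hi r
  have h8 := hK.lo_pos hcr
  have h9 := hK.lo_root
  rw [adj_iff] at h1 hadj
  by_cases hdr : d = r
  · subst hdr
    omega
  · have ih := ih hdr
    have h10 := lo_lt_hi d
    by_cases hs : Chord.lo k < Chord.hi r ∧ Chord.hi r < Chord.hi k
    · simp only [hs, and_self, iff_true] at ih ⊢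
      omega
    · simp only [hs, iff_false] at ih ⊢
      omega

/-- No endpoint of a chord of the share lies between the second endpoint of the root chord and a
point `y` outside of the share. -/
theorem not_between (hK : IsShare r m K) {y : ℕ} (hy0 : 0 < y)
    (hy : ∀ k ∈ K, y ≠ Chord.lo k ∧ y ≠ Chord.hi k ∧
      ((Chord.lo k < y ∧ y < Chord.hi k) ↔ (Chord.lo k < Chord.hi r ∧ Chord.hi r < Chord.hi k))) :
    ∀ k ∈ K, ¬ (min y (Chord.hi r) < Chord.lo k ∧ Chord.lo k < max y (Chord.hi r)) ∧
      ¬ (min y (Chord.hi r) < Chord.hi k ∧ Chord.hi k < max y (Chord.hi r)) := by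
  have h7 := lo_lt_hi r
  -- No chord of the share separates `y` from the end of the root chord, so one with an endpoint in
  -- the gap has both there and cannot cross one with none. The chord `m`, starting at `1`, has
  -- none.
  have key : ∀ k ∈ K, ¬ (min y (Chord.hi r) < Chord.lo k ∧ Chord.lo k < max y (Chord.hi r)) := by
    refine hK.induction_on _ ?_ ?_
    · have h1 := hK.lo_second
      omega
    · intro k hk k' hk' hadj ih
      have h1 := hy k hk
      have h2 := hy k' hk'
      have h3 := Chord.disjoint (ne_of_mem_of_not_mem hk hK.root_notMem)
      have h4 := Chord.disjoint (ne_of_mem_of_not_mem hk' hK.root_notMem)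
      have h5 := lo_lt_hi k
      have h6 := lo_lt_hi k'
      rw [adj_iff] at hadj
      rcases le_total y (Chord.hi r) with hle | hle
      · rw [min_eq_left hle, max_eq_right hle] at *
        omega
      · rw [min_eq_right hle, max_eq_left hle] at *
        omega
  intro k hk
  refine ⟨key k hk, ?_⟩
  have h1 := hy k hk
  have h2 := key k hk
  have h3 := Chord.disjoint (ne_of_mem_of_not_mem hk hK.root_notMem)
  have h5 := lo_lt_hi k
  rcases le_total y (Chord.hi r) with hle | hle
  · rw [min_eq_left hle, max_eq_right hle] at *
    omega
  · rw [min_eq_right hle, max_eq_left hle] at *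
    omega

/-- No point of the share lies between the second endpoint of the root chord and a point outside
of the share. -/
theorem not_between_points (hK : IsShare r m K) {y z : Fin (2 * n)} (hy0 : 0 < y.1)
    (hy : y ∉ points K) (hz : z ∈ points K) :
    ¬ (min y.1 (Chord.hi r) < z.1 ∧ z.1 < max y.1 (Chord.hi r)) := by
  obtain ⟨k, hk, hzk⟩ := mem_points.1 hz
  obtain ⟨c, hcy⟩ := C.exists_chord y
  have hcK : c ∉ K := fun h => hy (mem_points.2 ⟨c, h, hcy⟩)
  have hcy' : y.1 = Chord.lo c ∨ y.1 = Chord.hi c :=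
    hcy.imp (congrArg Fin.val) (congrArg Fin.val)
  have key := hK.not_between (y := y.1) hy0 (by
    intro k hk
    have h1 := Chord.disjoint (ne_of_mem_of_not_mem hk hcK)
    refine ⟨by omega, by omega, ?_⟩
    by_cases hcr : c = r
    · subst hcr
      have := hK.lo_root
      rcases hcy' with e | e
      · omega
      · rw [e]
    · have := hK.same_side hk c hcK hcr
      rcases hcy' with e | e
      · rw [e]; exact this.1
      · rw [e]; exact this.2) k hk
  have hzk' : z.1 = Chord.lo k ∨ z.1 = Chord.hi k :=
    hzk.imp (congrArg Fin.val) (congrArg Fin.val)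
  rcases hzk' with e | e
  · rw [e]; exact key.1
  · rw [e]; exact key.2

/-- The points outside of the share are the root and those of an interval. -/
theorem exists_slot (hK : IsShare r m K) (hcross : ∃ k ∈ K, Chord.hi r < Chord.hi k) :
    ∃ a b j, IsSlot n a b j ∧ ∀ p : Fin (2 * n), p ∈ points K ↔
      0 < p.1 ∧ p.1 ≤ j ∨ j + 2 * a ≤ p.1 := by
  set Q : Finset (Fin (2 * n)) := (Finset.univ \ points K).filter fun p => 0 < p.1 with hQ
  have memQ : ∀ p, p ∈ Q ↔ p ∉ points K ∧ 0 < p.1 := by simp [hQ]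
  have hrK : r.1 ∉ points K := fun h => hK.root_notMem (mem_points_lo.1 h)
  have hr0 : r.1.1 = 0 := hK.lo_root
  have hrQ : C.partner r.1 ∈ Q :=
    (memQ _).2 ⟨fun h => hrK (partner_mem_points.1 h), lt_of_le_of_lt (Nat.zero_le _) (lo_lt_hi r)⟩
  have hQne : Q.Nonempty := ⟨_, hrQ⟩
  set lo := Q.min' hQne with hlo
  set hi := Q.max' hQne with hhi
  have loQ : lo ∈ Q := Q.min'_mem hQne
  have hiQ : hi ∈ Q := Q.max'_mem hQne
  have lor : lo ≤ C.partner r.1 := Q.min'_le _ hrQ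
  have rhi : C.partner r.1 ≤ hi := Q.le_max' _ hrQ
  have notK : ∀ p : Fin (2 * n), lo ≤ p → p ≤ hi → p ∉ points K := by
    intro p h1 h2 hp
    have h3 := hK.not_between_points ((memQ _).1 loQ).2 ((memQ _).1 loQ).1 hp
    have h4 := hK.not_between_points ((memQ _).1 hiQ).2 ((memQ _).1 hiQ).1 hp
    have h5 : p ≠ lo := fun e => ((memQ _).1 loQ).1 (e ▸ hp)
    have h6 : p ≠ hi := fun e => ((memQ _).1 hiQ).1 (e ▸ hp)
    have h7 : p ≠ C.partner r.1 := fun e => ((memQ _).1 hrQ).1 (e ▸ hp)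
    have h5 := Fin.val_ne_of_ne h5
    have h6 := Fin.val_ne_of_ne h6
    have h7 : p.1 ≠ Chord.hi r := Fin.val_ne_of_ne h7
    have lor : lo.1 ≤ Chord.hi r := lor
    have rhi : Chord.hi r ≤ hi.1 := rhi
    rw [Fin.le_def] at h1 h2
    omega
  have hQI : Q = Finset.Icc lo hi := by
    ext p
    rw [Finset.mem_Icc]
    refine ⟨fun h => ⟨Q.min'_le _ h, Q.le_max' _ h⟩, fun h => (memQ p).2 ⟨notK p h.1 h.2, ?_⟩⟩
    exact lt_of_lt_of_le ((memQ _).1 loQ).2 h.1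
  have hcard : 2 * n = 1 + Q.card + 2 * K.card := by
    have e1 : (Finset.univ : Finset (Fin (2 * n))) = insert r.1 (Q ∪ points K) := by
      ext p
      simp only [Finset.mem_univ, Finset.mem_insert, Finset.mem_union, true_iff, memQ]
      by_cases hp : p ∈ points K
      · exact Or.inr (Or.inr hp)
      · rcases Nat.eq_zero_or_pos p.1 with h0 | h0
        · exact Or.inl (Fin.ext (h0.trans hr0.symm))
        · exact Or.inr (Or.inl ⟨hp, h0⟩)
    have e2 := congrArg Finset.card e1
    rw [Finset.card_insert_of_notMem, Finset.card_union_of_disjoint, card_points,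
      Finset.card_univ, Fintype.card_fin] at e2
    · omega
    · rw [Finset.disjoint_left]
      exact fun p hp => ((memQ p).1 hp).1
    · rw [Finset.mem_union, memQ]
      rintro (h | h)
      · omega
      · exact hrK h
  rw [hQI, Fin.card_Icc] at hcard
  have hlohi : lo.1 ≤ hi.1 := lor.trans rhi
  have lo0 : 0 < lo.1 := ((memQ _).1 loQ).2
  have hm : m.1 ∉ Q := fun h => ((memQ _).1 h).1 (mem_points_lo.2 hK.second_mem)
  have hlo1 : lo.1 ≠ 1 := by
    intro e
    have : lo = m.1 := Fin.ext (e.trans hK.lo_second.symm)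
    exact hm (this ▸ loQ)
  -- A chord of the share ends beyond the root chord, hence after the whole interval `Q`; this keeps
  -- the slot strictly inside the share.
  have hilt : hi.1 + 1 < 2 * n := by
    obtain ⟨k, hk, hk'⟩ := hcross
    have hkK : C.partner k.1 ∈ points K := partner_mem_points.2 (mem_points_lo.2 hk)
    have h1 : ¬ C.partner k.1 ≤ hi := fun h2 =>
      notK _ (lor.trans (le_of_lt (Fin.lt_def.2 hk'))) h2 hkK
    have := (C.partner k.1).2
    rw [Fin.le_def] at h1
    omega
  -- The interval `Q` consists of the `2 * a - 1` points from `j + 1` to `j + 2 * a - 1`, so `j` is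
  -- one less than its minimum.
  refine ⟨n - K.card, K.card, lo.1 - 1, ⟨by omega, by omega, by omega, by omega⟩, fun p => ?_⟩
  have hp : p ∈ points K ↔ 0 < p.1 ∧ p ∉ Q := by
    rw [memQ]
    constructor
    · intro h
      refine ⟨Nat.pos_of_ne_zero fun e => hrK ?_, fun h' => h'.1 h⟩
      rwa [show r.1 = p from Fin.ext (hr0.trans e.symm)]
    · rintro ⟨h1, h2⟩
      by_contra h3
      exact h2 ⟨h3, h1⟩
  rw [hp, hQI, Finset.mem_Icc, Fin.le_def, Fin.le_def]
  omega

end IsShare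

theorem IsConnected.exists_isInsertion (hC : C.IsConnected) (hn : 2 ≤ n) :
    ∃ (a b j : ℕ) (h : IsSlot n a b j) (C₁ : RootedChordDiagram a) (C₂ : RootedChordDiagram b),
      C₁.IsConnected ∧ C₂.IsConnected ∧ IsInsertion h C₁ C₂ C := by
  obtain ⟨m, hK⟩ := hC.exists_isShare hn
  set r := C.root (by omega) with hr
  set K := C.component (Finset.univ.erase r) m with hKdef
  -- Otherwise no chord of the share would cross the root chord, and the share could not be
  -- connected to it.
  have hcross : ∃ k ∈ K, Chord.hi r < Chord.hi k := by
    by_contra! hcon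
    have key : ∀ c d, ReflTransGen C.intersectionGraph.Adj c d → c ∈ K → d ∈ K := by
      intro c d hcd hc
      induction hcd with
      | refl => exact hc
      | @tail x y _ hxy ih =>
        refine hK.mem_of_adj x ih y hxy fun e => ?_
        have h1 := hcon x ih
        have h2 := hK.lo_root
        rw [e, adj_iff] at hxy
        omega
    exact hK.root_notMem (key _ _ ((C.isConnected_iff.1 hC).2 m r) hK.second_mem)
  obtain ⟨a, b, j, h, hp⟩ := hK.exists_slot hcross
  have hright : ∀ p, p ∈ Set.range (shareEmb h) ↔ p ∈ points K := fun p => by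
    rw [mem_range_shareEmb, hp]
  have hleft : ∀ p, p ∈ Set.range (rootEmb h) ↔ p ∉ points K := fun p => by
    rw [← hright, mem_range_shareEmb_iff_not, not_not]
  obtain ⟨C₁, h₁⟩ := C.exists_restriction (strictMono_rootEmb h) fun p hp => by
    rw [hleft] at hp ⊢
    rwa [partner_mem_points]
  obtain ⟨C₂, h₂⟩ := C.exists_restriction (strictMono_shareEmb h) fun p hp => by
    rw [hright] at hp ⊢
    rwa [partner_mem_points]
  have hI : IsInsertion h C₁ C₂ C := ⟨h₁, h₂⟩
  have mem₁ : ∀ c, h₁.chordMap c ∉ K := fun c => by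
    rw [← mem_points_lo, ← hleft]
    exact ⟨c.1, rfl⟩
  have mem₂ : ∀ c, h₂.chordMap c ∈ K := fun c => by
    rw [← mem_points_lo, ← hright]
    exact ⟨c.1, rfl⟩
  have sym : ∀ {k : ℕ} (D : RootedChordDiagram k) x y, ReflTransGen D.intersectionGraph.Adj x y →
      ReflTransGen D.intersectionGraph.Adj y x := by
    intro k D x y hxy
    rw [← SimpleGraph.reachable_iff_reflTransGen] at hxy ⊢
    exact hxy.symm
  refine ⟨a, b, j, h, C₁, C₂, ?_, ?_, hI⟩
  · have key : ∀ c, c ∉ K → ∀ d, h₁.chordMap d = c →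
        ReflTransGen C₁.intersectionGraph.Adj d (C₁.root h.pos_left) := by
      refine hK.induction_off _ ?_ ?_
      · intro d hd
        rw [hr, ← hI.chordMap_root] at hd
        rw [h₁.chordMap.injective hd]
      · rintro _ hc hcr c' hc' hadj ih d rfl
        rcases hI.exists_chordMap c' with ⟨y, rfl⟩ | ⟨y, rfl⟩
        · exact ReflTransGen.head (h₁.adj_chordMap.1 hadj) (ih y rfl)
        · exact absurd (mem₂ y) hc'
    refine C₁.isConnected_iff.2 ⟨⟨C₁.root h.pos_left⟩, fun v w => ?_⟩
    exact (key _ (mem₁ v) v rfl).trans (sym _ _ _ (key _ (mem₁ w) w rfl))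
  · obtain ⟨m', hm'⟩ : ∃ m', m = h₂.chordMap m' := by
      rcases hI.exists_chordMap m with ⟨y, hy⟩ | hy
      · exact absurd (hy ▸ hK.second_mem) (mem₁ y)
      · exact hy
    have key : ∀ c ∈ K, ∀ d, h₂.chordMap d = c →
        ReflTransGen C₂.intersectionGraph.Adj m' d := by
      refine hK.induction_on _ ?_ ?_
      · intro d hd
        rw [hm'] at hd
        rw [h₂.chordMap.injective hd]
      · rintro c hc _ hc' hadj ih d rfl
        rcases hI.exists_chordMap c with ⟨y, rfl⟩ | ⟨y, rfl⟩
        · exact absurd hc (mem₁ y)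
        · exact (ih y rfl).tail (h₂.adj_chordMap.1 hadj)
    refine C₂.isConnected_iff.2 ⟨⟨m'⟩, fun v w => ?_⟩
    exact (sym _ _ _ (key _ (mem₂ v) v rfl)).trans (key _ (mem₂ w) w rfl)

/-- The left side depends only on `C`, so the sizes and the slot can be read off from `C`. -/
theorem IsInsertion.points_component {a b j : ℕ} {h : IsSlot n a b j} {C₁ : RootedChordDiagram a}
    {C₂ : RootedChordDiagram b} (hC : IsInsertion h C₁ C₂ C) (h₂ : C₂.IsConnected) (hn : 0 < n)
    {m : C.Chord} (hm : Chord.lo m = 1) (p : Fin (2 * n)) :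
    p ∈ points (C.component (Finset.univ.erase (C.root hn)) m) ↔
      0 < p.1 ∧ p.1 ≤ j ∨ j + 2 * a ≤ p.1 := by
  have e : m = hC.right.chordMap (C₂.root h₂.pos) :=
    Chord.ext_lo (hm.trans (hC.lo_chordMap_root h₂.pos).symm)
  rw [e, ← hC.chordMap_root hn, hC.component_eq h₂, ← mem_range_shareEmb h, mem_points]
  constructor
  · rintro ⟨c, hc, hpc⟩
    obtain ⟨d, -, rfl⟩ := Finset.mem_map.1 hc
    rcases hpc with rfl | rfl
    · exact ⟨d.1, rfl⟩
    · exact ⟨C₂.partner d.1, (hC.right.partner _).symm⟩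
  · rintro ⟨q, rfl⟩
    obtain ⟨d, hd⟩ := C₂.exists_chord q
    refine ⟨hC.right.chordMap d, Finset.mem_map.2 ⟨d, Finset.mem_univ _, rfl⟩, ?_⟩
    rcases hd with rfl | rfl
    · exact Or.inl rfl
    · exact Or.inr (hC.right.partner _).symm

theorem IsInsertion.slot_unique {a b j a' b' j' : ℕ} {h : IsSlot n a b j} {h' : IsSlot n a' b' j'}
    {C₁ : RootedChordDiagram a} {C₂ : RootedChordDiagram b} {C₁' : RootedChordDiagram a'}
    {C₂' : RootedChordDiagram b'} (hC : IsInsertion h C₁ C₂ C) (hC' : IsInsertion h' C₁' C₂' C)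
    (h₂ : C₂.IsConnected) (h₂' : C₂'.IsConnected) : a = a' ∧ b = b' ∧ j = j' := by
  obtain ⟨s1, s2, s3, s4⟩ := id h
  obtain ⟨t1, t2, t3, t4⟩ := id h'
  have hn : 0 < n := by omega
  have key := fun p => (hC.points_component h₂ hn (hC.lo_chordMap_root h₂.pos) p).symm.trans
    (hC'.points_component h₂' hn (hC.lo_chordMap_root h₂.pos) p)
  -- The points `j + 1` and `j + 2 * a` are where the share is left and entered again. Testing those
  -- of both insertions forces the two intervals to agree.
  have k1 := key ⟨j + 1, by omega⟩
  have k2 := key ⟨j' + 1, by omega⟩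
  have k3 := key ⟨j + 2 * a, by omega⟩
  have k4 := key ⟨j' + 2 * a', by omega⟩
  simp only at k1 k2 k3 k4
  omega

theorem IsEmbedding.unique {m : ℕ} {D D' : RootedChordDiagram m} {φ : Fin (2 * m) → Fin (2 * n)}
    (h : IsEmbedding D C φ) (h' : IsEmbedding D' C φ) : D = D' := by
  ext1
  funext p
  exact h.strictMono.injective ((h.partner p).symm.trans (h'.partner p))

end Decomposition

end RootedChordDiagram

namespace RootedChordDiagram

open Finset.HasAntidiagonal

/-! ### The statistics of an insertion -/

section Statistics

theorem isTerminal_of_one (C : RootedChordDiagram 1) (c : C.Chord) : C.IsTerminal c := by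
  intro d hd
  have hs : Subsingleton C.Chord := Fintype.card_le_one_iff_subsingleton.1 C.card_chord.le
  rw [Subsingleton.elim d c] at hd
  exact lt_irrefl _ hd.1

theorem word_of_one (C : RootedChordDiagram 1) : C.word = [true] := by
  have : C.word = List.replicate 1 true := by
    refine List.eq_replicate_iff.2 ⟨by rw [length_word, card_chord], fun x hx => ?_⟩
    obtain ⟨c, -, rfl⟩ := List.mem_map.1 hx
    simpa using C.isTerminal_of_one c
  simpa using this

/-- By induction: the word of an insertion ends like that of `C₁`, or like that of `C₂` when `C₁` is
a single chord. -/
theorem IsConnected.getLast?_word {n : ℕ} {C : RootedChordDiagram n} (hC : C.IsConnected) :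
    true ∈ C.word.getLast? := by
  induction n using Nat.strong_induction_on with
  | _ n ih =>
    rcases Nat.lt_or_ge n 2 with hn | hn
    · obtain rfl : n = 1 := by have := hC.pos; omega
      simp [C.word_of_one]
    · obtain ⟨a, b, j, h, C₁, C₂, h₁, h₂, hI⟩ := hC.exists_isInsertion hn
      have ha := h.pos_left
      have hb := h₂.pos
      have hab := h.add_eq
      have l₁ := ih a (by omega) h₁
      have l₂ := ih b (by omega) h₂
      rw [hI.word_eq h₁ h₂]
      rcases hw : C₁.word with _ | ⟨x, _ | ⟨y, t⟩⟩
      · simp [hw] at l₁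
      · rw [List.tail_cons, List.append_nil, List.getLast?_cons]
        rw [Option.mem_def] at l₂
        simp [l₂]
      · rw [hw] at l₁
        rw [List.tail_cons, ← List.cons_append, List.getLast?_append]
        rw [List.getLast?_cons_cons, Option.mem_def] at l₁
        simp [l₁]

theorem IsConnected.true_mem_word {n : ℕ} {C : RootedChordDiagram n} (hC : C.IsConnected) :
    true ∈ C.word := List.mem_of_mem_getLast? hC.getLast?_word

theorem IsConnected.one_le_b {n : ℕ} {C : RootedChordDiagram n} (hC : C.IsConnected) :
    1 ≤ C.b := by
  rw [C.b_eq_first hC.true_mem_word]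
  exact TerminalWord.one_le_first _

theorem IsConnected.b_le {n : ℕ} {C : RootedChordDiagram n} (hC : C.IsConnected) :
    C.b ≤ n := by
  rw [C.b_eq_first hC.true_mem_word]
  refine (TerminalWord.first_le_length hC.true_mem_word).trans_eq ?_
  rw [C.length_word, C.card_chord]

variable {n a b j : ℕ} {h : IsSlot n a b j} {C₁ : RootedChordDiagram a}
  {C₂ : RootedChordDiagram b} {C : RootedChordDiagram n}

theorem IsInsertion.b_eq (hC : IsInsertion h C₁ C₂ C) (h₁ : C₁.IsConnected)
    (h₂ : C₂.IsConnected) : C.b = C₂.b + 1 := by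
  rw [C.b_eq_first (hC.isConnected h₁ h₂).true_mem_word, C₂.b_eq_first h₂.true_mem_word,
    hC.word_eq h₁ h₂, TerminalWord.first, TerminalWord.first_append h₂.true_mem_word]

theorem IsInsertion.monomial_eq {R : Type*} [CommRing R] (f : ℕ → R)
    (hC : IsInsertion h C₁ C₂ C) (h₁ : C₁.IsConnected) (h₂ : C₂.IsConnected) :
    C.monomial f = f (C₁.b - 1) * C₁.monomial f * C₂.monomial f := by
  rw [C.monomial_eq_weight f (hC.isConnected h₁ h₂).true_mem_word,
    C₁.monomial_eq_weight f h₁.true_mem_word, C₂.monomial_eq_weight f h₂.true_mem_word,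
    C₁.b_eq_first h₁.true_mem_word, hC.word_eq h₁ h₂, TerminalWord.weight,
    TerminalWord.weight_append f h₂.getLast?_word]
  have hl := h₁.getLast?_word
  rcases hw : C₁.word with _ | ⟨x, t⟩
  · simp [hw] at hl
  · rw [hw] at hl
    rw [← TerminalWord.mul_weightFrom_tail f hl, List.tail_cons]
    ring

end Statistics

/-! ### Sums over connected diagrams -/

section Sums

/-- The connected diagrams with `n` chords. -/
abbrev Connected (n : ℕ) : Type := {C : RootedChordDiagram n // C.IsConnected}

/-- The data of an insertion that gives a connected diagram with `n` chords: the sizes, the two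
diagrams and the slot. -/
abbrev InsertionData (n : ℕ) : Type :=
  Σ q : antidiagonal n, Connected q.1.1 × Connected q.1.2 × Fin (2 * q.1.2 - 1)

theorem InsertionData.isSlot {n : ℕ} (d : InsertionData n) :
    IsSlot n d.1.1.1 d.1.1.2 (d.2.2.2.1 + 1) :=
  ⟨d.2.1.2.pos, by omega, by have := d.2.2.2.2; omega, mem_antidiagonal.1 d.1.2⟩

/-- The connected diagram given by the data of an insertion. -/
def InsertionData.glue {n : ℕ} (d : InsertionData n) : Connected n :=
  ⟨insertion d.isSlot d.2.1.1 d.2.2.1.1,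
    (isInsertion_insertion d.isSlot _ _).isConnected d.2.1.2 d.2.2.1.2⟩

theorem InsertionData.isInsertion {n : ℕ} (d : InsertionData n) :
    IsInsertion d.isSlot d.2.1.1 d.2.2.1.1 d.glue.1 :=
  isInsertion_insertion d.isSlot _ _

theorem InsertionData.glue_bijective {n : ℕ} (hn : 2 ≤ n) :
    Function.Bijective (InsertionData.glue (n := n)) := by
  constructor
  · intro d d' e
    have I := d.isInsertion
    have I' := d'.isInsertion
    rw [← e] at I'
    obtain ⟨ea, eb, ej⟩ := I.slot_unique I' d.2.2.1.2 d'.2.2.1.2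
    obtain ⟨⟨⟨a, b⟩, hq⟩, ⟨C₁, h₁⟩, ⟨C₂, h₂⟩, ⟨j, hj⟩⟩ := d
    obtain ⟨⟨⟨a', b'⟩, hq'⟩, ⟨C₁', h₁'⟩, ⟨C₂', h₂'⟩, ⟨j', hj'⟩⟩ := d'
    dsimp only at ea eb ej
    obtain rfl : j = j' := by omega
    subst ea eb
    obtain rfl : C₁ = C₁' := I.left.unique I'.left
    obtain rfl : C₂ = C₂' := I.right.unique I'.right
    rfl
  · rintro ⟨C, hC⟩
    obtain ⟨a, b, j, h, C₁, C₂, h₁, h₂, hI⟩ := hC.exists_isInsertion hn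
    obtain ⟨s1, s2, s3, s4⟩ := id h
    obtain ⟨j, rfl⟩ : ∃ i, j = i + 1 := ⟨j - 1, by omega⟩
    let d : InsertionData n := ⟨⟨(a, b), mem_antidiagonal.2 s4⟩, ⟨C₁, h₁⟩, ⟨C₂, h₂⟩,
      ⟨j, by change j < 2 * b - 1; omega⟩⟩
    exact ⟨d, Subtype.ext (d.isInsertion.unique hI)⟩

instance uniqueConnectedOne : Unique (Connected 1) where
  default := ⟨⟨Fin.rev, Fin.rev_rev, by decide⟩, by
    refine (isConnected_iff _).2 ⟨⟨root _ Nat.one_pos⟩, fun v w => ?_⟩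
    have hs : Subsingleton (Chord (⟨Fin.rev, Fin.rev_rev, by decide⟩ : RootedChordDiagram 1)) :=
      Fintype.card_le_one_iff_subsingleton.1 (card_chord _).le
    rw [Subsingleton.elim v w]⟩
  uniq C := by
    refine Subtype.ext (RootedChordDiagram.ext (funext fun p => ?_))
    have h1 := C.1.partner_ne p
    have h2 := p.2
    have h3 := (C.1.partner p).2
    rw [Ne, Fin.ext_iff] at h1
    refine Fin.ext ?_
    rw [Fin.val_rev]
    omega

instance isEmptyConnectedZero : IsEmpty (Connected 0) :=
  ⟨fun C => lt_irrefl 0 C.2.pos⟩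

variable {R : Type*} [CommRing R] (f : ℕ → R)

/-- The sum over the connected diagrams `C` with `n` chords of `g (b C) * f_C`. -/
def connectedSum (g : ℕ → R) (n : ℕ) : R := ∑ C : Connected n, g C.1.b * C.1.monomial f

theorem connectedSum_zero (g : ℕ → R) : connectedSum f g 0 = 0 := by
  rw [connectedSum, Fintype.sum_empty]

theorem connectedSum_one (g : ℕ → R) : connectedSum f g 1 = g 1 := by
  have h := (default : Connected 1).2.true_mem_word
  rw [connectedSum, Fintype.sum_unique, b_eq_first _ h, monomial_eq_weight _ _ h, word_of_one]
  simp [TerminalWord.first, TerminalWord.weight, TerminalWord.weightFrom]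

theorem connectedSum_eq_sum_ite (g : ℕ → R) (n : ℕ) : connectedSum f g n =
    ∑ C : RootedChordDiagram n, if C.IsConnected then g C.b * C.monomial f else 0 := by
  rw [connectedSum, ← Finset.sum_filter]
  exact (Finset.sum_subtype (p := fun C : RootedChordDiagram n => C.IsConnected) _ (by simp)
    fun C => g C.b * C.monomial f).symm

/-- The summand does not depend on the slot, so the choice of slot contributes the factor `2 * q.2 -
1`. -/
theorem connectedSum_of_two_le (g : ℕ → R) {n : ℕ} (hn : 2 ≤ n) :
    connectedSum f g n = ∑ q ∈ antidiagonal n, connectedSum f (fun b => f (b - 1)) q.1 *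
      ((2 * q.2 - 1 : R) * connectedSum f (fun b => g (b + 1)) q.2) := by
  rw [connectedSum, ← (InsertionData.glue_bijective hn).sum_comp, Fintype.sum_sigma,
    ← Finset.sum_coe_sort (antidiagonal n)]
  refine Finset.sum_congr rfl fun q _ => ?_
  rw [Fintype.sum_prod_type, connectedSum, Finset.sum_mul]
  refine Finset.sum_congr rfl fun C₁ _ => ?_
  rw [Fintype.sum_prod_type, connectedSum, Finset.mul_sum, Finset.mul_sum]
  refine Finset.sum_congr rfl fun C₂ _ => ?_
  have key : ∀ i : Fin (2 * q.1.2 - 1),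
      g (InsertionData.glue ⟨q, C₁, C₂, i⟩).1.b *
        (InsertionData.glue ⟨q, C₁, C₂, i⟩).1.monomial f =
      f (C₁.1.b - 1) * C₁.1.monomial f * (g (C₂.1.b + 1) * C₂.1.monomial f) := by
    intro i
    have I := InsertionData.isInsertion ⟨q, C₁, C₂, i⟩
    rw [I.b_eq C₁.2 C₂.2, I.monomial_eq f C₁.2 C₂.2]
    ring
  simp only [key, Finset.sum_const, Finset.card_univ, Fintype.card_fin, nsmul_eq_mul]
  have hb : 0 < q.1.2 := C₂.2.pos
  rw [Nat.cast_sub (by omega)]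
  push_cast
  ring

end Sums

end RootedChordDiagram

namespace DysonSchwinger

open PowerSeries RootedChordDiagram

/-! ### The recursion for the generating series of connected diagrams -/

section Recursion

variable {R : Type*} [CommRing R]

/-- The operator `2 x d/dx`. -/
def twiceEuler (φ : R⟦X⟧) : R⟦X⟧ := 2 * X * d⁄dX R φ

theorem coeff_twiceEuler (n : ℕ) (φ : R⟦X⟧) : coeff n (twiceEuler φ) = 2 * n * coeff n φ := by
  have h2 : (2 : R⟦X⟧) = C (2 : R) := (map_ofNat (C (R := R)) 2).symm
  rw [twiceEuler, mul_assoc, h2, coeff_C_mul]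
  rcases n with _ | n
  · simp
  · rw [coeff_succ_X_mul, coeff_derivative]
    push_cast
    ring

theorem derivative_mul {A : Type*} [CommRing A] (φ ψ : A⟦X⟧) :
    d⁄dX A (φ * ψ) = d⁄dX A φ * ψ + φ * d⁄dX A ψ := by
  rw [Derivation.leibniz, smul_eq_mul, smul_eq_mul, add_comm, mul_comm ψ]

theorem twiceEuler_mul (φ ψ : R⟦X⟧) :
    twiceEuler (φ * ψ) = twiceEuler φ * ψ + φ * twiceEuler ψ := by
  simp only [twiceEuler, derivative_mul]
  ring

theorem twiceEuler_C (r : R) : twiceEuler (C r) = 0 := by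
  rw [twiceEuler, derivative_C, mul_zero]

theorem twiceEuler_zero : twiceEuler (0 : R⟦X⟧) = 0 := by
  rw [twiceEuler, map_zero, mul_zero]

theorem twiceEuler_neg (φ : R⟦X⟧) : twiceEuler (-φ) = -twiceEuler φ := by
  rw [twiceEuler, map_neg, mul_neg, twiceEuler]

theorem twiceEuler_one : twiceEuler (1 : R⟦X⟧) = 0 := by
  rw [← map_one (C (R := R)), twiceEuler_C]

theorem twiceEuler_C_mul (r : R) (φ : R⟦X⟧) : twiceEuler (C r * φ) = C r * twiceEuler φ := by
  rw [twiceEuler_mul, twiceEuler_C, zero_mul, zero_add]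

theorem twiceEuler_X : twiceEuler (X : R⟦X⟧) = 2 * X := by
  rw [twiceEuler, derivative_X, mul_one]

theorem twiceEuler_sum {ι : Type*} (s : Finset ι) (φ : ι → R⟦X⟧) :
    twiceEuler (∑ i ∈ s, φ i) = ∑ i ∈ s, twiceEuler (φ i) := by
  simp only [twiceEuler, map_sum, Finset.mul_sum]

variable (f : ℕ → R)

/-- The series `∑ g (b C) f_C x ^ |C|` over the connected diagrams `C`. -/
def connectedSeries (g : ℕ → R) : R⟦X⟧ := mk (connectedSum f g)

/-- The series `∑ f (b C - 1) f_C x ^ |C|` over the connected diagrams `C`. -/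
def rootSeries : R⟦X⟧ := connectedSeries f fun b => f (b - 1)

theorem connectedSeries_eq (g : ℕ → R) :
    connectedSeries f g = C (g 1) * X + rootSeries f *
      (twiceEuler (connectedSeries f fun b => g (b + 1)) -
        connectedSeries f fun b => g (b + 1)) := by
  ext n
  rw [map_add, coeff_C_mul, coeff_X, coeff_mul]
  simp only [map_sub, coeff_twiceEuler, rootSeries, connectedSeries, coeff_mk]
  rcases Nat.lt_or_ge n 2 with hn | hn
  · interval_cases n
    · simp [connectedSum_zero]
    · simp [Finset.Nat.antidiagonal_succ, connectedSum_zero, connectedSum_one]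
  · rw [connectedSum_of_two_le f g hn, if_neg (by omega), mul_zero, zero_add]
    refine Finset.sum_congr rfl fun q _ => ?_
    ring

/-- The series `γ_i` without its numerical factor. -/
def gammaSeries (i : ℕ) : R⟦X⟧ := connectedSeries f fun b => if i ≤ b then f (b - i) else 0

theorem connectedSeries_congr {g g' : ℕ → R} (h : ∀ b, 1 ≤ b → g b = g' b) :
    connectedSeries f g = connectedSeries f g' := by
  ext n
  simp only [connectedSeries, coeff_mk, connectedSum]
  exact Finset.sum_congr rfl fun C _ => by rw [h _ C.2.one_le_b]

theorem gammaSeries_one : gammaSeries f 1 = rootSeries f :=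
  connectedSeries_congr f fun b hb => by rw [if_pos hb]

theorem gammaSeries_succ {i : ℕ} (hi : 1 ≤ i) : gammaSeries f (i + 1) =
    rootSeries f * (twiceEuler (gammaSeries f i) - gammaSeries f i) := by
  rw [gammaSeries, connectedSeries_eq, if_neg (by omega), map_zero, zero_mul, zero_add]
  simp only [Nat.add_le_add_iff_right, Nat.add_sub_add_right]
  rfl

/-- The series `∑ f_C x ^ (|C| - 1)` over the connected diagrams `C` with `b C = b`. -/
def firstSeries (b : ℕ) : R⟦X⟧ :=
  mk fun n => connectedSum f (fun b' => if b' = b then 1 else 0) (n + 1)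

theorem X_mul_firstSeries (b : ℕ) :
    X * firstSeries f b = connectedSeries f fun b' => if b' = b then 1 else 0 := by
  ext n
  rcases n with _ | n
  · rw [coeff_zero_X_mul, connectedSeries, coeff_mk, connectedSum_zero]
  · rw [coeff_succ_X_mul, firstSeries, coeff_mk, connectedSeries, coeff_mk]

/-- Only the single chord has `b = 1`, since an insertion has `b(C) = b(C₂) + 1 ≥ 2`. -/
theorem firstSeries_one : firstSeries f 1 = 1 := by
  refine X_mul_cancel ?_
  have h0 : (connectedSeries f fun b => if b + 1 = 1 then 1 else 0) = 0 := by
    rw [connectedSeries_congr f (g' := fun _ => 0) fun b hb => if_neg (by omega)]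
    ext n
    simp [connectedSeries, connectedSum]
  rw [X_mul_firstSeries, connectedSeries_eq, h0]
  simp [twiceEuler]

/-- Dividing by `X` turns the operator `E - 1` of `connectedSeries_eq` into `E + 1`, because `E X =
2 X`. -/
theorem firstSeries_succ {b : ℕ} (hb : 1 ≤ b) : firstSeries f (b + 1) =
    rootSeries f * (twiceEuler (firstSeries f b) + firstSeries f b) := by
  refine X_mul_cancel ?_
  rw [X_mul_firstSeries, connectedSeries_eq, if_neg (by omega), map_zero, zero_mul, zero_add]
  simp only [Nat.add_right_cancel_iff]
  rw [← X_mul_firstSeries, twiceEuler_mul, twiceEuler_X]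
  ring

theorem coeff_firstSeries_of_lt {b n : ℕ} (h : n + 1 < b) : coeff n (firstSeries f b) = 0 := by
  rw [firstSeries, coeff_mk, connectedSum]
  refine Finset.sum_eq_zero fun C _ => ?_
  have := C.2.b_le
  rw [if_neg (by omega), zero_mul]

theorem sum_coeff_firstSeries (g : ℕ → R) (n : ℕ) :
    ∑ k ∈ Finset.range (n + 1), coeff n (firstSeries f (k + 1)) * g (k + 1) =
      connectedSum f g (n + 1) := by
  simp only [firstSeries, coeff_mk, connectedSum, Finset.sum_mul]
  rw [Finset.sum_comm]
  refine Finset.sum_congr rfl fun C _ => ?_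
  have h1 := C.2.b_le
  have h2 := C.2.one_le_b
  rw [Finset.sum_eq_single (C.1.b - 1)]
  · rw [Nat.sub_add_cancel h2, if_pos rfl]
    ring
  · intro k _ hk
    rw [if_neg (by omega), zero_mul, zero_mul]
  · intro hk
    exact absurd (Finset.mem_range.2 (by omega)) hk

theorem coeff_greenSeries_zero (γ : ℕ → R⟦X⟧) : coeff 0 (greenSeries γ) = 1 := by
  simp [greenSeries]

theorem coeff_greenSeries {k : ℕ} (hk : 1 ≤ k) (γ : ℕ → R⟦X⟧) :
    coeff k (greenSeries γ) = -γ k := by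
  rw [greenSeries, map_sub, coeff_one, if_neg (by omega), coeff_mk, if_pos hk, zero_sub]

end Recursion

/-! ### The inverse of the Green function -/

section Inverse

variable (R : Type*) [CommRing R] [Algebra ℚ R]

/-- The coefficient `(-1)^i / i!` of `e^{-x}`. -/
def expNegCoeff (i : ℕ) : R := algebraMap ℚ R ((-1) ^ i / (i.factorial : ℚ))

theorem expNegCoeff_zero : expNegCoeff R 0 = 1 := by simp [expNegCoeff]

theorem expNegCoeff_succ_mul (i : ℕ) : expNegCoeff R (i + 1) * (i + 1 : R) = -expNegCoeff R i := by
  have h : (i + 1 : R) = algebraMap ℚ R (i + 1) := by simp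
  rw [h, expNegCoeff, expNegCoeff, ← map_mul, ← map_neg]
  congr 1
  have h1 : ((i : ℚ) + 1) ≠ 0 := by positivity
  have h2 : (i.factorial : ℚ) ≠ 0 := by positivity
  rw [Nat.factorial_succ]
  push_cast
  field_simp
  ring

theorem neg_one_pow_mul_factorial_mul_expNegCoeff (i : ℕ) :
    (-1 : R) ^ i * (i.factorial : R) * expNegCoeff R i = 1 := by
  have h : (-1 : R) ^ i * (i.factorial : R) = algebraMap ℚ R ((-1) ^ i * i.factorial) := by simp
  rw [h, expNegCoeff, ← map_mul, ← map_one (algebraMap ℚ R)]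
  congr 1
  have h2 : (i.factorial : ℚ) ≠ 0 := by positivity
  field_simp
  rw [← pow_mul, mul_comm, pow_mul]
  simp

variable {R} (f : ℕ → R)

theorem gamma_eq (i : ℕ) : gamma f i = C (expNegCoeff R i) * gammaSeries f i := by
  ext n
  rw [coeff_C_mul, gamma, coeff_mk, gammaSeries, connectedSeries, coeff_mk,
    connectedSum_eq_sum_ite, expNegCoeff]
  congr 1
  refine Finset.sum_congr rfl fun C _ => ?_
  by_cases h1 : C.IsConnected <;> by_cases h2 : i ≤ C.b <;> simp [h1, h2, mul_comm]

/-- The inverse of the Green function. -/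
def greenInverse : R⟦X⟧⟦X⟧ := mk fun k => C (expNegCoeff R k) * firstSeries f (k + 1)

theorem C_expNegCoeff_succ_mul (k : ℕ) :
    C (expNegCoeff R (k + 1)) * ((k : R⟦X⟧) + 1) = -C (expNegCoeff R k) := by
  have h : (k : R⟦X⟧) + 1 = C ((k : R) + 1) := by simp
  rw [h, ← map_mul, expNegCoeff_succ_mul, map_neg]

theorem coeff_derivative_greenSeries (k : ℕ) :
    coeff k (d⁄dX R⟦X⟧ (greenSeries (gamma f))) = -(rootSeries f *
      (twiceEuler (coeff k (greenSeries (gamma f))) - coeff k (greenSeries (gamma f)))) := by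
  rw [coeff_derivative, coeff_greenSeries (by omega), gamma_eq]
  have h : -(C (expNegCoeff R (k + 1)) * gammaSeries f (k + 1)) * ((k : R⟦X⟧) + 1) =
      C (expNegCoeff R k) * gammaSeries f (k + 1) := by
    linear_combination (-gammaSeries f (k + 1)) * C_expNegCoeff_succ_mul (R := R) k
  rw [h]
  rcases Nat.eq_zero_or_pos k with rfl | hk
  · rw [coeff_greenSeries_zero, twiceEuler_one, expNegCoeff_zero, gammaSeries_one, map_one]
    ring
  · rw [coeff_greenSeries hk, gamma_eq, gammaSeries_succ f hk, twiceEuler_neg, twiceEuler_C_mul]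
    ring

theorem coeff_derivative_greenInverse (k : ℕ) :
    coeff k (d⁄dX R⟦X⟧ (greenInverse f)) = -(rootSeries f *
      (twiceEuler (coeff k (greenInverse f)) + coeff k (greenInverse f))) := by
  rw [coeff_derivative, greenInverse, coeff_mk, coeff_mk, firstSeries_succ f (by omega),
    twiceEuler_C_mul]
  linear_combination (rootSeries f * (twiceEuler (firstSeries f (k + 1)) +
    firstSeries f (k + 1))) * C_expNegCoeff_succ_mul (R := R) k

theorem coeff_derivative_mul (k : ℕ) :
    coeff k (d⁄dX R⟦X⟧ (greenSeries (gamma f) * greenInverse f)) =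
      -(rootSeries f * twiceEuler (coeff k (greenSeries (gamma f) * greenInverse f))) := by
  rw [derivative_mul, map_add, coeff_mul, coeff_mul, coeff_mul, twiceEuler_sum,
    Finset.mul_sum, ← Finset.sum_neg_distrib, ← Finset.sum_add_distrib]
  refine Finset.sum_congr rfl fun q _ => ?_
  rw [coeff_derivative_greenSeries, coeff_derivative_greenInverse, twiceEuler_mul]
  ring

theorem green_mul_inverse : greenSeries (gamma f) * greenInverse f = 1 := by
  have h0 : coeff 0 (greenSeries (gamma f) * greenInverse f) = 1 := by
    rw [coeff_mul]
    simp [coeff_greenSeries_zero, greenInverse, expNegCoeff_zero, firstSeries_one,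
      -coeff_zero_eq_constantCoeff]
  -- The ring may have zero divisors, but `k + 1` is a unit in a `ℚ`-algebra.
  have cancel : ∀ (k : ℕ) (φ : R⟦X⟧), φ * ((k : R⟦X⟧) + 1) = 0 → φ = 0 := by
    intro k φ h
    have hu : algebraMap ℚ R⟦X⟧ (k + 1) * algebraMap ℚ R⟦X⟧ ((k + 1)⁻¹) = 1 := by
      rw [← map_mul, mul_inv_cancel₀ (by positivity), map_one]
    have e : (k : R⟦X⟧) + 1 = algebraMap ℚ R⟦X⟧ (k + 1) := by simp
    rw [e] at h
    rw [← mul_one φ, ← hu, ← mul_assoc, h, zero_mul]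
  ext1 k
  induction k with
  | zero => rw [h0, coeff_zero_one]
  | succ k ih =>
    have h1 := coeff_derivative_mul f k
    -- The coefficient of `L^k` in the product is the constant `1` or `0`, which `E` kills; the
    -- differential equation then kills the next one.
    have h2 : twiceEuler (coeff k (greenSeries (gamma f) * greenInverse f)) = 0 := by
      rw [ih, coeff_one]
      split_ifs
      · exact twiceEuler_one
      · exact twiceEuler_zero
    rw [h2, mul_zero, neg_zero, coeff_derivative] at h1
    rw [cancel k _ h1, coeff_one, if_neg (by omega)]

end Inverse

/-! ### Convergence of the operator series -/

section Operator

variable {R : Type*} [CommRing R]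

/-- The partial sums of `H(x, ∂_{-ρ}) Φ`. -/
def operatorSum (H : R⟦X⟧⟦X⟧) (Φ : R⟦X⟧⟦X⟧⟦X⟧) (N : ℕ) : R⟦X⟧⟦X⟧⟦X⟧ :=
  ∑ k ∈ Finset.range N, C (C (coeff k H)) * negDeriv^[k] Φ

/-- The sum of `H(x, ∂_{-ρ}) Φ` when the `k`-th coefficient of `H` is divisible by `x ^ k`. -/
def operatorValue (H : R⟦X⟧⟦X⟧) (Φ : R⟦X⟧⟦X⟧⟦X⟧) : R⟦X⟧⟦X⟧⟦X⟧ :=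
  mk fun r => mk fun m => mk fun n => coeff n (coeff m (coeff r (operatorSum H Φ (n + 1))))

theorem coeff_operatorSum (H : R⟦X⟧⟦X⟧) (Φ : R⟦X⟧⟦X⟧⟦X⟧) (N r m : ℕ) :
    coeff m (coeff r (operatorSum H Φ N)) =
      ∑ k ∈ Finset.range N, coeff k H * coeff m (coeff r (negDeriv^[k] Φ)) := by
  simp only [operatorSum, map_sum, coeff_C_mul]

theorem isOperatorValue_operatorValue {H : R⟦X⟧⟦X⟧} (hH : ∀ k, X ^ k ∣ coeff k H)
    (Φ : R⟦X⟧⟦X⟧⟦X⟧) : IsOperatorValue H Φ (operatorValue H Φ) := by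
  intro r m n
  filter_upwards [Filter.eventually_ge_atTop (n + 1)] with N hN
  change coeff n (coeff m (coeff r (operatorSum H Φ N))) = _
  rw [operatorValue, coeff_mk, coeff_mk, coeff_mk, coeff_operatorSum, coeff_operatorSum, map_sum,
    map_sum]
  refine (Finset.sum_subset (Finset.range_subset_range.2 hN) fun k _ hk => ?_).symm
  rw [Finset.mem_range, not_lt] at hk
  exact X_pow_dvd_iff.1 (Dvd.dvd.mul_right (hH k) _) n (by omega)

end Operator

/-! ### The equation -/

section Equation

variable {R : Type*} [CommRing R] [Algebra ℚ R] (f : ℕ → R)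

theorem coeff_expNegLRho (i : ℕ) :
    coeff i (expNegLRho R) = C (C (expNegCoeff R i)) * (X : R⟦X⟧⟦X⟧) ^ i := by
  have h : ∀ q : ℚ, algebraMap ℚ R⟦X⟧⟦X⟧ q = C (C (algebraMap ℚ R q)) := fun q =>
    RingHom.congr_fun (Subsingleton.elim (algebraMap ℚ R⟦X⟧⟦X⟧)
      ((C (R := R⟦X⟧)).comp ((C (R := R)).comp (algebraMap ℚ R)))) q
  have e : expNegCoeff R i = (-1) ^ i * algebraMap ℚ R (1 / i.factorial) := by
    rw [expNegCoeff, div_eq_mul_one_div, map_mul, map_pow, map_neg, map_one]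
  rw [expNegLRho, coeff_rescale, coeff_exp, h, e, neg_pow]
  simp only [map_mul, map_pow, map_neg, map_one]
  ring

/-- The power series `(e^{-Lρ} - 1) F(ρ)`. -/
def kernelSeries : R⟦X⟧⟦X⟧⟦X⟧ :=
  mk fun r => mk fun m =>
    C (expNegCoeff R m * if 1 ≤ m ∧ m ≤ r + 1 then f (r + 1 - m) else 0)

/-- The factor `X` clears the simple pole of `F`, so the comparison takes place among power series.
-/
theorem X_mul_kernelSeries : X * kernelSeries f =
    (expNegLRho R - 1) * mk fun k => C (C (f k)) := by
  have h : ∀ i m, coeff m (coeff i (expNegLRho R - 1)) =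
      C (if i = m ∧ 1 ≤ i then expNegCoeff R i else 0) := by
    intro i m
    rw [map_sub, coeff_expNegLRho, map_sub, coeff_C_mul, coeff_X_pow, coeff_one]
    rcases Nat.eq_zero_or_pos i with rfl | hi
    · rcases Nat.eq_zero_or_pos m with rfl | hm
      · simp [expNegCoeff_zero]
      · simp [hm.ne', hm.ne]
    · rw [if_neg hi.ne']
      by_cases hm : m = i
      · subst hm
        have hi' : 1 ≤ m := hi
        simp [hi']
      · simp [hm, Ne.symm hm]
  ext1 r
  ext1 m
  rw [coeff_mul _ (expNegLRho R - 1), map_sum]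
  simp only [coeff_mk, coeff_mul_C, h]
  rcases r with _ | r
  · simp
  · rw [coeff_succ_X_mul, kernelSeries, coeff_mk, coeff_mk,
      Finset.Nat.sum_antidiagonal_eq_sum_range_succ_mk]
    simp only [← map_mul, ← map_sum]
    congr 1
    by_cases hm : 1 ≤ m ∧ m ≤ r + 1
    · rw [if_pos hm, Finset.sum_eq_single m]
      · rw [if_pos ⟨rfl, hm.1⟩]
      · intro i _ hi
        rw [if_neg (fun e => hi e.1), zero_mul]
      · intro hi
        exact absurd (Finset.mem_range.2 (by omega)) hi
    · rw [if_neg hm, mul_zero]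
      refine (Finset.sum_eq_zero fun i hi => ?_).symm
      have := Finset.mem_range.1 hi
      rw [if_neg (by omega), zero_mul]

theorem ofPowerSeries_kernelSeries :
    HahnSeries.ofPowerSeries ℤ R⟦X⟧⟦X⟧ (kernelSeries f) =
      HahnSeries.ofPowerSeries ℤ R⟦X⟧⟦X⟧ (expNegLRho R - 1) * laurentF f := by
  rw [laurentF, mul_left_comm, ← map_mul, ← X_mul_kernelSeries, map_mul,
    HahnSeries.ofPowerSeries_X, ← mul_assoc, HahnSeries.single_mul_single]
  simp

theorem constantCoeff_negDeriv_iterate {A : Type*} [CommRing A] (Φ : A⟦X⟧) (k : ℕ) :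
    constantCoeff (negDeriv^[k] Φ) = (-1) ^ k * (k.factorial : A) * coeff k Φ := by
  have h : negDeriv^[k] Φ = (-1) ^ k * (d⁄dX A)^[k] Φ := by
    induction k with
    | zero => simp
    | succ k ih =>
      have hc : ((-1 : A⟦X⟧)) ^ k = C ((-1) ^ k) := by simp
      rw [Function.iterate_succ_apply', Function.iterate_succ_apply', ih, negDeriv, hc,
        Derivation.leibniz, derivative_C, smul_zero, add_zero, smul_eq_mul, ← hc, pow_succ]
      ring
  have hc : ((-1 : A⟦X⟧)) ^ k = C ((-1) ^ k) := by simp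
  rw [h, hc, map_mul, constantCoeff_C, constantCoeff_iterate_derivative, mul_assoc]

/-- A diagram with `b(C) = k + 1` has at least `k + 1` chords, and `firstSeries` has one factor `x`
removed. -/
theorem X_pow_dvd_coeff_greenInverse (k : ℕ) : X ^ k ∣ coeff k (greenInverse f) := by
  rw [greenInverse, coeff_mk]
  refine Dvd.dvd.mul_left (X_pow_dvd_iff.2 fun n hn => ?_) _
  exact coeff_firstSeries_of_lt f (by omega)

theorem coeff_greenInverse_mul (k m : ℕ) :
    coeff k (greenInverse f) * coeff m (coeff 0 (negDeriv^[k] (kernelSeries f))) =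
      firstSeries f (k + 1) *
        C (expNegCoeff R m * if 1 ≤ m ∧ m ≤ k + 1 then f (k + 1 - m) else 0) := by
  have hc : ((-1 : R⟦X⟧⟦X⟧)) ^ k * (k.factorial : R⟦X⟧⟦X⟧) =
      C (C ((-1) ^ k * (k.factorial : R))) := by simp
  rw [coeff_zero_eq_constantCoeff_apply, constantCoeff_negDeriv_iterate, hc, coeff_C_mul,
    greenInverse, coeff_mk, kernelSeries, coeff_mk, coeff_mk]
  have h : C ((-1) ^ k * (k.factorial : R)) * C (expNegCoeff R k) = 1 := by
    rw [← map_mul, neg_one_pow_mul_factorial_mul_expNegCoeff, map_one]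
  linear_combination (firstSeries f (k + 1) *
    C (expNegCoeff R m * if 1 ≤ m ∧ m ≤ k + 1 then f (k + 1 - m) else 0)) * h

theorem greenSeries_eq : greenSeries (gamma f) = 1 - C (X : R⟦X⟧) *
    constantCoeff (operatorValue (greenInverse f) (kernelSeries f)) := by
  ext1 m
  rw [map_sub, coeff_C_mul, ← coeff_zero_eq_constantCoeff_apply, operatorValue, coeff_mk, coeff_mk]
  -- The `n + 1` terms kept in `operatorValue` exhaust the diagrams with `n + 1` chords, for which
  -- `1 ≤ b(C) ≤ n + 1`. The shift from `n` to `n + 1` is the factor `x` of the equation.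
  have key : ∀ n, coeff n (coeff m (coeff 0
      (operatorSum (greenInverse f) (kernelSeries f) (n + 1)))) =
      expNegCoeff R m * connectedSum f
        (fun b => if 1 ≤ m ∧ m ≤ b then f (b - m) else 0) (n + 1) := by
    intro n
    rw [coeff_operatorSum, map_sum, ← sum_coeff_firstSeries, Finset.mul_sum]
    refine Finset.sum_congr rfl fun k _ => ?_
    rw [coeff_greenInverse_mul, coeff_mul_C]
    ring
  simp only [key]
  rcases Nat.eq_zero_or_pos m with rfl | hm
  · rw [coeff_greenSeries_zero, coeff_zero_one]
    have h : ∀ n, connectedSum f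
        (fun b => if 1 ≤ 0 ∧ 0 ≤ b then f (b - 0) else 0) n = 0 := fun n => by
      simp [connectedSum]
    simp only [h, mul_zero]
    have h0 : (mk fun _ => 0 : R⟦X⟧) = 0 := by
      ext n
      simp
    rw [h0, mul_zero, sub_zero]
  · rw [coeff_greenSeries hm, coeff_one, if_neg hm.ne', zero_sub, gamma_eq]
    congr 1
    ext n
    rw [coeff_C_mul, gammaSeries, connectedSeries, coeff_mk]
    have hm' : 1 ≤ m := hm
    rcases n with _ | n
    · rw [connectedSum_zero, coeff_zero_X_mul, mul_zero]
    · rw [coeff_succ_X_mul, coeff_mk]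
      simp only [hm', true_and]

end Equation

end DysonSchwinger

end

theorem mainTheorem1 {R : Type*} [CommRing R] [Algebra ℚ R] (f : ℕ → R) :
    DysonSchwinger.IsSolution f
      (DysonSchwinger.greenSeries (DysonSchwinger.gamma f)) :=
  ⟨DysonSchwinger.greenInverse f, DysonSchwinger.kernelSeries f,
    DysonSchwinger.operatorValue (DysonSchwinger.greenInverse f) (DysonSchwinger.kernelSeries f),
    DysonSchwinger.green_mul_inverse f, DysonSchwinger.ofPowerSeries_kernelSeries f,
    DysonSchwinger.isOperatorValue_operatorValue
      (DysonSchwinger.X_pow_dvd_coeff_greenInverse f) _,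
    DysonSchwinger.greenSeries_eq f⟩
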